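/- Let $n\ge 1$ and let $(T_k)_{k\in\mathbb{Z}^n}$ be an action of $\mathbb{Z}^n$ by measure-preserving automorphisms of a standard Borel probability space $(X,\mathscr{A},\mu)$, where $\mu$ has no atoms. Assume that the action is of rank one (with rectangular towers): there are sets $E_j\in\mathscr{A}$ and rectangles $R_j=\{0,\dots,h_j(1)-1\}\times\cdots\times\{0,\dots,h_j(n)-1\}\subset\mathbb{Z}^n$, $j\in\mathbb{N}$, such that for each $j$ the sets $T_kE_j$ $(k\in R_j)$ are pairwise disjoint, and the partitions $$\xi_j=\Bigl\{(T_kE_j)_{k\in R_j},\ X\setminus\bigsqcup_{k\in R_j}T_kE_j\Bigr\}$$ converge to the partition into points, i.e. for every $A\in\mathscr{A}$ there are sets $A_j$, each a union of elements of $\xi_j$, with $\mu(A\,\triangle\,A_j)\to0$. Let $\mathscr{F}\subset\mathscr{A}$ be a factor, i.e. a sub-$\sigma$-algebra invariant under all $T_k$, which is non-trivial in the sense that it does not coincide with $\mathscr{A}$ modulo $\mu$-null sets. Then $\mathscr{F}$ is partially rigid: there is a sequence $(k_j)$ in $\mathbb{Z}^n$ with $|k_j|\to\infty$ such that for all $A,B\in\mathscr{F}$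 $$\liminf_{j\to\infty}\mu(A\cap T_{k_j}B)\ \ge\ \frac{1}{2^n}\,\mu(A\cap B).$$ -/

import Mathlib

open Filter Topology MeasureTheory
open scoped ENNReal Pointwise

namespace RankOneZn

/-- The rectangle `{0, …, h(1) - 1} × ⋯ × {0, …, h(n) - 1}` in `ℤⁿ`. -/
def rect {n : ℕ} (h : Fin n → ℕ) : Set (Fin n → ℤ) :=
  {k | ∀ i, 0 ≤ k i ∧ k i < (h i : ℤ)}

/-- The family `{(T_k E)_{k ∈ R}, X \ ⋃_{k ∈ R} T_k E}` for the rectangle `R = rect h`. Here and below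
`T_k x = k +ᵥ x`, and `k +ᵥ E` is the image `T_k E`. -/
def towerPartition {n : ℕ} {X : Type*} [AddAction (Fin n → ℤ) X]
    (h : Fin n → ℕ) (E : Set X) : Set (Set X) :=
  insert (⋃ k ∈ rect h, (k +ᵥ E))ᶜ ((fun k : Fin n → ℤ => k +ᵥ E) '' rect h)

/-- A set is measurable for a finite partition `ξ` when it is a union of elements of `ξ`. -/
def MeasurableFor {X : Type*} (ξ : Set (Set X)) (A : Set X) : Prop :=
  ∃ S ⊆ ξ, A = ⋃₀ S

/-- The sequence of finite partitions `ξ j` converges to the partition into points: every measurable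
set is approximated in measure by `ξ j`-measurable sets. -/
def ConvergesToPoints {X : Type*} {m : MeasurableSpace X} (μ : Measure X)
    (ξ : ℕ → Set (Set X)) : Prop :=
  ∀ A : Set X, MeasurableSet[m] A →
    ∃ A' : ℕ → Set X, (∀ j, MeasurableFor (ξ j) (A' j)) ∧
      Tendsto (fun j => μ (symmDiff A (A' j))) atTop (𝓝 0)

/-- The given action of `ℤⁿ` on `(X, μ)` is of rank one (with rectangular towers). -/
def IsRankOne (n : ℕ) {X : Type*} {m : MeasurableSpace X} [AddAction (Fin n → ℤ) X]
    (μ : Measure X) : Prop :=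
  ∃ (h : ℕ → Fin n → ℕ) (E : ℕ → Set X),
    (∀ j, MeasurableSet[m] (E j)) ∧
    (∀ j, (rect (h j)).PairwiseDisjoint fun k => k +ᵥ E j) ∧
    ConvergesToPoints μ fun j => towerPartition (h j) (E j)

/-- A factor: a sub-σ-algebra that is invariant under the action. -/
structure IsFactor (n : ℕ) {X : Type*} (m : MeasurableSpace X) [AddAction (Fin n → ℤ) X]
    (F : MeasurableSpace X) : Prop where
  le : F ≤ m
  invariant : ∀ (k : Fin n → ℤ) (A : Set X), MeasurableSet[F] A → MeasurableSet[F] (k +ᵥ A)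

/-- `F` is not the whole σ-algebra modulo `μ`-null sets. -/
def IsProper {X : Type*} {m : MeasurableSpace X} (μ : Measure X) (F : MeasurableSpace X) : Prop :=
  ∃ A : Set X, MeasurableSet[m] A ∧ ∀ B : Set X, MeasurableSet[F] B → ¬ A =ᵐ[μ] B

end RankOneZn

/-!
# Partial rigidity of proper factors of rank-one `ℤⁿ`-actions

Let `F` be a proper factor and let `ν` be the relatively independent self-joining of `μ` over `F`.
It vanishes on `(A ∩ B) × Bᶜ` for `A, B ∈ F`, and, since `F` is proper, it charges some `A₀ × A₀ᶜ`.

Consider a tower with levels `L_a = a +ᵥ E`, `a ∈ R`. By invariance `ν (L_a × L_b)` depends only on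
`k = a - b`, so on unions of levels `ν` is a combination of the off-diagonal measures
`A × B ↦ μ (D_k ∩ A ∩ T_k B)`, where `D_k` is the union of the levels over `R ∩ (R + k)`
(`IsSelfJoining.sum_overlap_le`). A pair `(a, b)` with `a` in the centre of the rectangle `R` has
`μ (D_{a - b})` at least about `2⁻ⁿ` (`exists_centre_rectFinset`). These pairs carry a definite part
of the mass of `ν` even when the diagonal `a = b` is removed, as `ν` charges `A₀ × A₀ᶜ`
(`IsSelfJoining.le_sum_ne`). Since `ν` vanishes on the translates of `(A ∩ B) × Bᶜ`, there is
therefore some `k ≠ 0` of this form for which `D_k ∩ T_g (A ∩ B) ∩ T_k T_g Bᶜ` is small, on average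
over `g` in a finite set (`IsTowerSeq.exists_ne_zero_le`). Averaging over `g` also makes
`T_g (A ∩ B)` uncorrelated with `D_k`, by the mean ergodic theorem (`IsTowerSeq.exists_average`), so
that
`μ (A ∩ T_k B) = μ (T_g A ∩ T_k T_g B) ≳ μ (D_k) μ (A ∩ B) ≳ 2⁻ⁿ μ (A ∩ B)`.
Taking the average over translates first is what makes it unnecessary that the side lengths of the
rectangles tend to infinity, or that `ν` be ergodic.

It remains to let `k` tend to infinity. If some `k ≠ 0` fixes all sets of `F` up to null sets, its
multiples are a rigidity sequence (`hasRigiditySeq_of_periodic`). Otherwise each `k ≠ 0` maps some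
set of `F` of positive measure off itself. Such a set violates the inequality for this `k`, so
adding finitely many of these sets to the family excludes any finite set of `k`
(`exists_seq_of_finite_family`).
-/

namespace RankOneZn

/-! ### Towers and self-joinings -/

section Towers

variable {G X : Type*} [AddCommGroup G] [AddAction G X]

/-- The union of the levels `a +ᵥ E`, `a ∈ P`. -/
def tower (P : Finset G) (E : Set X) : Set X := ⋃ a ∈ P, (a +ᵥ E)

/-- The part `R ∩ (R + k)` of the index set `R`: the levels of a tower over `R` whose image under
`-k` is again a level. -/
def overlap [DecidableEq G] (R : Finset G) (k : G) : Finset G := R.filter fun a => a - k ∈ R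

lemma overlap_subset [DecidableEq G] (R : Finset G) (k : G) : overlap R k ⊆ R :=
  Finset.filter_subset _ _

lemma mem_tower {P : Finset G} {E : Set X} {x : X} :
    x ∈ tower P E ↔ ∃ a ∈ P, x ∈ a +ᵥ E := by simp [tower]

lemma tower_mono {P Q : Finset G} (h : P ⊆ Q) (E : Set X) : tower P E ⊆ tower Q E := by
  intro x hx
  obtain ⟨a, ha, hx⟩ := mem_tower.1 hx
  exact mem_tower.2 ⟨a, h ha, hx⟩

variable [m : MeasurableSpace X] [MeasurableConstVAdd G X]

lemma measurableSet_tower (P : Finset G) {E : Set X} (hE : MeasurableSet E) :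
    MeasurableSet (tower P E) :=
  Finset.measurableSet_biUnion _ fun a _ => hE.const_vadd a

variable (μ : Measure X) [VAddInvariantMeasure G X μ]

omit [MeasurableConstVAdd G X] in
lemma measureReal_vadd (g : G) (A : Set X) : μ.real (g +ᵥ A) = μ.real A := by
  simp [measureReal_def, measure_vadd]

variable [IsProbabilityMeasure μ]

lemma measureReal_tower {R P : Finset G} {E : Set X} (hE : MeasurableSet E)
    (hd : (R : Set G).PairwiseDisjoint fun a => a +ᵥ E) (hP : P ⊆ R) :
    μ.real (tower P E) = P.card * μ.real E := by
  rw [tower, measureReal_biUnion_finset (hd.subset (by exact_mod_cast hP))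
    (fun a _ => hE.const_vadd a)]
  simp [measureReal_vadd]

variable {μ}

lemma measureReal_le_add_symmDiff {Y : Type*} [MeasurableSpace Y] (ν : Measure Y)
    [IsFiniteMeasure ν] (A B : Set Y) : ν.real A ≤ ν.real B + ν.real (symmDiff A B) := by
  refine (measureReal_mono (s₂ := B ∪ symmDiff A B) ?_).trans (measureReal_union_le _ _)
  intro x hx
  by_cases h : x ∈ B <;> simp [Set.mem_symmDiff, hx, h]

end Towers

section Joining

/-- An invariant self-joining of the action on `(X, μ)`: a measure on `X × X` with both marginals
equal to `μ` that is invariant under the diagonal action (stated for rectangles only). -/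
structure IsSelfJoining (G : Type*) {X : Type*} [AddCommGroup G] [AddAction G X]
    [MeasurableSpace X] (μ : Measure X) (ν : Measure (X × X)) : Prop where
  fst : ∀ A : Set X, MeasurableSet A → ν.real (A ×ˢ Set.univ) = μ.real A
  snd : ∀ A : Set X, MeasurableSet A → ν.real (Set.univ ×ˢ A) = μ.real A
  vadd : ∀ (g : G) (A B : Set X), MeasurableSet A → MeasurableSet B →
    ν.real ((g +ᵥ A) ×ˢ (g +ᵥ B)) = ν.real (A ×ˢ B)

variable {G X : Type*} [AddCommGroup G] [DecidableEq G] [AddAction G X] [m : MeasurableSpace X]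
  [MeasurableConstVAdd G X] {μ : Measure X} [VAddInvariantMeasure G X μ]
  [IsProbabilityMeasure μ] {ν : Measure (X × X)} [IsProbabilityMeasure ν]


omit [DecidableEq G] [VAddInvariantMeasure G X μ] [IsProbabilityMeasure μ]
  [IsProbabilityMeasure ν] in
lemma IsSelfJoining.prod_vadd_eq (hν : IsSelfJoining G μ ν) {E : Set X} (hE : MeasurableSet E)
    {a b c d : G} (h : c - d = a - b) :
    ν.real ((c +ᵥ E) ×ˢ (d +ᵥ E)) = ν.real ((a +ᵥ E) ×ˢ (b +ᵥ E)) := by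
  rw [← hν.vadd (a - c) _ _ (hE.const_vadd c) (hE.const_vadd d), vadd_vadd, vadd_vadd]
  have h1 : a - c + c = a := by abel
  have h2 : a - c + d = b := by
    rw [sub_add, h]; abel
  rw [h1, h2]

lemma measureReal_tower_prod {R P Q : Finset G} {E : Set X} (hE : MeasurableSet E)
    (hd : (R : Set G).PairwiseDisjoint fun a => a +ᵥ E) (hP : P ⊆ R) (hQ : Q ⊆ R) :
    ν.real (tower P E ×ˢ tower Q E) =
      ∑ c ∈ P, ∑ d ∈ Q, ν.real ((c +ᵥ E) ×ˢ (d +ᵥ E)) := by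
  have h : tower P E ×ˢ tower Q E = ⋃ p ∈ P ×ˢ Q, (p.1 +ᵥ E) ×ˢ (p.2 +ᵥ E) := by
    ext ⟨x, y⟩
    simp only [Set.mem_prod, mem_tower, Set.mem_iUnion, Finset.mem_product, exists_prop,
      Prod.exists]
    constructor
    · rintro ⟨⟨a, ha, hx⟩, b, hb, hy⟩
      exact ⟨a, b, ⟨ha, hb⟩, hx, hy⟩
    · rintro ⟨a, b, ⟨ha, hb⟩, hx, hy⟩
      exact ⟨⟨a, ha, hx⟩, b, hb, hy⟩
  rw [h, measureReal_biUnion_finset, Finset.sum_product]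
  · rintro ⟨a, b⟩ hp ⟨a', b'⟩ hp' hne
    simp only [Finset.coe_product, Set.mem_prod, Finset.mem_coe] at hp hp'
    rw [Function.onFun, Set.disjoint_prod]
    by_cases hab : a = a'
    · exact Or.inr (hd (hQ hp.2) (hQ hp'.2) fun hb => hne (by simp [hab, hb]))
    · exact Or.inl (hd (hP hp.1) (hP hp'.1) hab)
  · exact fun p _ => (hE.const_vadd _).prod (hE.const_vadd _)

lemma measureReal_overlap_inter_le {R P Q : Finset G} {E : Set X} (hE : MeasurableSet E)
    (hd : (R : Set G).PairwiseDisjoint fun a => a +ᵥ E) (hP : P ⊆ R) (hQ : Q ⊆ R) (k : G) :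
    μ.real (tower (overlap R k) E ∩ (tower P E ∩ (k +ᵥ tower Q E))) ≤
      (P.filter fun c => c - k ∈ Q).card * μ.real E := by
  rw [← measureReal_tower μ hE hd ((Finset.filter_subset _ _).trans hP)]
  refine measureReal_mono ?_
  rintro x ⟨hx, hxP, hxQ⟩
  obtain ⟨a, ha, hxa⟩ := mem_tower.1 hx
  rw [overlap, Finset.mem_filter] at ha
  obtain ⟨c, hc, hxc⟩ := mem_tower.1 hxP
  obtain ⟨y, hy, rfl⟩ := hxQ
  obtain ⟨d, hdQ, hyd⟩ := mem_tower.1 hy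
  have hac : a = c := hd.elim_set ha.1 (hP hc) _ hxa hxc
  have hy' : y ∈ (a - k) +ᵥ E := by
    obtain ⟨z, hz, hzx⟩ := hxa
    refine ⟨z, hz, ?_⟩
    have : y = -k +ᵥ (k +ᵥ y) := by simp
    rw [this]
    change (a - k) +ᵥ z = -k +ᵥ (fun x => k +ᵥ x) y
    rw [← hzx]
    simp only [vadd_vadd]
    congr 1
    abel
  have had : a - k = d := hd.elim_set ha.2 (hQ hdQ) _ hy' hyd
  refine mem_tower.2 ⟨c, Finset.mem_filter.2 ⟨hc, ?_⟩, hxc⟩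
  rw [← hac, had]
  exact hdQ

/-- Off-diagonal measures under a tower are dominated by a joining, for unions of levels. The
weight `ν (L_a × L_b)` depends only on `k = a - b`, and so does the number of pairs of levels in
`P × Q` with this difference; summation over `b` for fixed `a` meets each `k` at most once, and
the levels `L_a` have total measure at most one. -/
lemma IsSelfJoining.sum_overlap_tower_le (hν : IsSelfJoining G μ ν) {R P Q : Finset G} {E : Set X}
    (hE : MeasurableSet E)
    (hd : (R : Set G).PairwiseDisjoint fun a => a +ᵥ E) (hP : P ⊆ R) (hQ : Q ⊆ R) :
    ∑ a ∈ R, ∑ b ∈ R, ν.real ((a +ᵥ E) ×ˢ (b +ᵥ E)) *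
        μ.real (tower (overlap R (a - b)) E ∩ (tower P E ∩ ((a - b) +ᵥ tower Q E))) ≤
      ν.real (tower P E ×ˢ tower Q E) := by
  set v : G → G → ℝ := fun a b => ν.real ((a +ᵥ E) ×ˢ (b +ᵥ E)) with hv
  have hv0 : ∀ a b, 0 ≤ v a b := fun a b => measureReal_nonneg
  have key : ∀ a, ∑ b ∈ R, v a b * (P.filter fun c => c - (a - b) ∈ Q).card ≤
      ν.real (tower P E ×ˢ tower Q E) := by
    intro a
    rw [measureReal_tower_prod hE hd hP hQ]
    have h1 : ∀ b ∈ R, v a b * (P.filter fun c => c - (a - b) ∈ Q).card =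
        ∑ c ∈ P, ∑ d ∈ Q, if b = a - c + d then v c d else 0 := by
      intro b _
      rw [Finset.card_filter, Nat.cast_sum, Finset.mul_sum]
      refine Finset.sum_congr rfl fun c _ => ?_
      have h2 : ∀ d ∈ Q, (if b = a - c + d then v c d else 0) =
          if c - (a - b) = d then v a b else 0 := by
        intro d _
        have h3 : b = a - c + d ↔ c - (a - b) = d := by
          constructor
          · rintro rfl; abel
          · rintro rfl; abel
        by_cases h : b = a - c + d
        · rw [if_pos h, if_pos (h3.1 h)]
          refine hν.prod_vadd_eq hE ?_
          rw [h]; abel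
        · rw [if_neg h, if_neg (fun h' => h (h3.2 h'))]
      rw [Finset.sum_congr rfl h2, Finset.sum_ite_eq]
      split_ifs <;> simp
    rw [Finset.sum_congr rfl h1, Finset.sum_comm]
    refine Finset.sum_le_sum fun c _ => ?_
    rw [Finset.sum_comm]
    refine Finset.sum_le_sum fun d _ => ?_
    rw [Finset.sum_ite_eq']
    split_ifs
    · exact le_rfl
    · exact hv0 _ _
  calc _ ≤ ∑ a ∈ R, ν.real (tower P E ×ˢ tower Q E) * μ.real E := by
        refine Finset.sum_le_sum fun a _ => ?_
        refine le_trans ?_ (mul_le_mul_of_nonneg_right (key a) measureReal_nonneg)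
        rw [Finset.sum_mul]
        refine Finset.sum_le_sum fun b _ => ?_
        rw [mul_assoc]
        exact mul_le_mul_of_nonneg_left (measureReal_overlap_inter_le hE hd hP hQ _) (hv0 _ _)
    _ = ν.real (tower P E ×ˢ tower Q E) * μ.real (tower R E) := by
        rw [measureReal_tower μ hE hd subset_rfl, Finset.sum_const, nsmul_eq_mul]
        ring
    _ ≤ _ := mul_le_of_le_one_right measureReal_nonneg measureReal_le_one

omit [DecidableEq G] [MeasurableConstVAdd G X] [VAddInvariantMeasure G X μ]
  [IsProbabilityMeasure μ] in
lemma IsSelfJoining.symmDiff_prod_le (hν : IsSelfJoining G μ ν) {A A' B B' : Set X}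
    (hA : MeasurableSet A) (hA' : MeasurableSet A') (hB : MeasurableSet B)
    (hB' : MeasurableSet B') :
    ν.real (A ×ˢ B) ≤ ν.real (A' ×ˢ B') + μ.real (symmDiff A A') + μ.real (symmDiff B B') := by
  rw [← hν.fst _ (hA.symmDiff hA'), ← hν.snd _ (hB.symmDiff hB')]
  refine le_trans (measureReal_mono (s₂ := (A' ×ˢ B' ∪ (symmDiff A A') ×ˢ Set.univ) ∪
    Set.univ ×ˢ (symmDiff B B')) ?_) ((measureReal_union_le _ _).trans
      (add_le_add_left (measureReal_union_le _ _) _))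
  rintro ⟨x, y⟩ ⟨hx, hy⟩
  simp only [Set.mem_prod, Set.mem_union, Set.mem_symmDiff, Set.mem_univ] at *
  tauto

lemma sum_prod_levels_le_one {R : Finset G} {E : Set X}
    (hE : MeasurableSet E) (hd : (R : Set G).PairwiseDisjoint fun a => a +ᵥ E) :
    ∑ a ∈ R, ∑ b ∈ R, ν.real ((a +ᵥ E) ×ˢ (b +ᵥ E)) ≤ 1 := by
  rw [← measureReal_tower_prod hE hd subset_rfl subset_rfl]
  exact measureReal_le_one

/-- The domination of off-diagonal measures by a joining, for arbitrary measurable sets that are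
approximated by unions of levels. -/
lemma IsSelfJoining.sum_overlap_le (hν : IsSelfJoining G μ ν) {R P Q : Finset G} {E A B : Set X}
    (hE : MeasurableSet E) (hd : (R : Set G).PairwiseDisjoint fun a => a +ᵥ E) (hP : P ⊆ R)
    (hQ : Q ⊆ R) (hA : MeasurableSet A) (hB : MeasurableSet B) :
    ∑ a ∈ R, ∑ b ∈ R, ν.real ((a +ᵥ E) ×ˢ (b +ᵥ E)) *
        μ.real (tower (overlap R (a - b)) E ∩ (A ∩ ((a - b) +ᵥ B))) ≤
      ν.real (A ×ˢ B) +
        2 * (μ.real (symmDiff A (tower P E)) + μ.real (symmDiff B (tower Q E))) := by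
  set e := μ.real (symmDiff A (tower P E)) + μ.real (symmDiff B (tower Q E)) with he
  have he0 : 0 ≤ e := add_nonneg measureReal_nonneg measureReal_nonneg
  have h1 : ∀ k : G, μ.real (tower (overlap R k) E ∩ (A ∩ (k +ᵥ B))) ≤
      μ.real (tower (overlap R k) E ∩ (tower P E ∩ (k +ᵥ tower Q E))) + e := by
    intro k
    rw [he, ← measureReal_vadd μ k (symmDiff B (tower Q E)), ← add_assoc]
    refine le_trans (measureReal_mono (s₂ := (tower (overlap R k) E ∩ (tower P E ∩
      (k +ᵥ tower Q E)) ∪ (symmDiff A (tower P E))) ∪ (k +ᵥ symmDiff B (tower Q E))) ?_)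
      ((measureReal_union_le _ _).trans (add_le_add_left (measureReal_union_le _ _) _))
    rintro x ⟨hx, hxA, y, hy, rfl⟩
    have hk : ∀ S : Set X, k +ᵥ y ∈ k +ᵥ S ↔ y ∈ S := fun S => Set.vadd_mem_vadd_set_iff
    simp only [Set.mem_inter_iff, Set.mem_union, Set.mem_symmDiff, hk] at *
    tauto
  have h2 := hν.sum_overlap_tower_le hE hd hP hQ
  have h3 := hν.symmDiff_prod_le (measurableSet_tower P hE) hA (measurableSet_tower Q hE) hB
  rw [symmDiff_comm, symmDiff_comm (tower Q E)] at h3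
  have h4 : ∑ a ∈ R, ∑ b ∈ R, ν.real ((a +ᵥ E) ×ˢ (b +ᵥ E)) * e ≤ e := by
    simp_rw [← Finset.sum_mul]
    exact mul_le_of_le_one_left he0 (sum_prod_levels_le_one hE hd)
  calc _ ≤ ∑ a ∈ R, ∑ b ∈ R, (ν.real ((a +ᵥ E) ×ˢ (b +ᵥ E)) *
        μ.real (tower (overlap R (a - b)) E ∩ (tower P E ∩ ((a - b) +ᵥ tower Q E))) +
        ν.real ((a +ᵥ E) ×ˢ (b +ᵥ E)) * e) := by
        refine Finset.sum_le_sum fun a _ => Finset.sum_le_sum fun b _ => ?_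
        rw [← mul_add]
        exact mul_le_mul_of_nonneg_left (h1 _) measureReal_nonneg
    _ ≤ _ := by
        simp_rw [Finset.sum_add_distrib]
        linarith

/-- The joining gives definite mass to the pairs of distinct levels whose first member lies in a
positive proportion `C` of the tower, as soon as it charges some `A × Aᶜ`. -/
lemma IsSelfJoining.le_sum_ne (hν : IsSelfJoining G μ ν) {C R P : Finset G} {E A : Set X}
    (hE : MeasurableSet E) (hd : (R : Set G).PairwiseDisjoint fun a => a +ᵥ E) (hP : P ⊆ R)
    (hA : MeasurableSet A) {δ : ℝ} (hδ : 0 ≤ δ) (hC : C ⊆ R) (hcard : δ * R.card ≤ C.card) :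
    δ * (μ.real (tower R E) - 1 + ν.real (A ×ˢ Aᶜ) - 2 * μ.real (symmDiff A (tower P E))) -
        (1 - μ.real (tower R E)) ≤
      ∑ a ∈ C, ∑ b ∈ R.erase a, ν.real ((a +ᵥ E) ×ˢ (b +ᵥ E)) := by
  set v : G → G → ℝ := fun a b => ν.real ((a +ᵥ E) ×ˢ (b +ᵥ E)) with hv
  have hmR := measurableSet_tower R hE
  have hmP := measurableSet_tower P hE
  have hdiag : ∀ a, v a a = v 0 0 := fun a => hν.prod_vadd_eq hE (by simp)
  -- the diagonal blocks miss `tower P × (tower P)ᶜ`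
  have h1 : R.card * v 0 0 + ν.real (tower P E ×ˢ (tower P E)ᶜ) ≤ 1 := by
    have h : R.card * v 0 0 = ν.real (⋃ a ∈ R, (a +ᵥ E) ×ˢ (a +ᵥ E)) := by
      rw [measureReal_biUnion_finset]
      · rw [Finset.sum_congr rfl fun a _ => hdiag a]
        simp
      · intro a ha b hb hab
        rw [Function.onFun, Set.disjoint_prod]
        exact Or.inl (hd ha hb hab)
      · exact fun a _ => (hE.const_vadd _).prod (hE.const_vadd _)
    rw [h, ← measureReal_union (h₁ := measure_ne_top _ _) (h₂ := measure_ne_top _ _) ?_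
      (hmP.prod hmP.compl)]
    · exact measureReal_le_one
    · rw [Set.disjoint_left]
      rintro ⟨x, y⟩ hx ⟨hxP, hyP⟩
      simp only [Set.mem_iUnion, Set.mem_prod, exists_prop] at hx
      obtain ⟨a, ha, hxa, hya⟩ := hx
      obtain ⟨c, hc, hxc⟩ := mem_tower.1 hxP
      have : a = c := hd.elim_set ha (hP hc) _ hxa hxc
      exact hyP (mem_tower.2 ⟨a, this ▸ hc, hya⟩)
  have h2 := hν.symmDiff_prod_le hA hmP hA.compl hmP.compl
  rw [compl_symmDiff_compl] at h2
  have h3 : ∑ a ∈ C, ∑ b ∈ R, v a b = ν.real (tower C E ×ˢ tower R E) :=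
    (measureReal_tower_prod hE hd hC subset_rfl).symm
  have h4 : μ.real (tower C E) ≤ ν.real (tower C E ×ˢ tower R E) + (1 - μ.real (tower R E)) := by
    rw [← hν.fst _ (measurableSet_tower C hE), ← probReal_compl_eq_one_sub hmR,
      ← hν.snd _ hmR.compl]
    refine (measureReal_mono ?_).trans (measureReal_union_le _ _)
    rintro ⟨x, y⟩ ⟨hx, -⟩
    by_cases hy : y ∈ tower R E <;> simp [hx, hy]
  rw [measureReal_tower μ hE hd hC] at h4
  have hR := measureReal_tower μ hE hd (subset_refl R)
  have h5 : ∑ a ∈ C, ∑ b ∈ R.erase a, v a b =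
      (∑ a ∈ C, ∑ b ∈ R, v a b) - C.card * v 0 0 := by
    rw [eq_sub_iff_add_eq, ← nsmul_eq_mul, ← Finset.sum_const, ← Finset.sum_add_distrib]
    refine Finset.sum_congr rfl fun a ha => ?_
    rw [← hdiag a, Finset.sum_erase_add _ _ (hC ha)]
  have h6 : 0 ≤ μ.real E - v 0 0 := by
    have : v 0 0 ≤ ν.real (E ×ˢ Set.univ) :=
      measureReal_mono (by simp only [zero_vadd]; exact Set.prod_mono_right (Set.subset_univ _))
    rw [hν.fst _ hE] at this
    linarith
  have h7 := mul_le_mul_of_nonneg_right hcard h6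
  have h8 : δ * (μ.real (tower R E) - 1 + ν.real (A ×ˢ Aᶜ) -
      2 * μ.real (symmDiff A (tower P E))) ≤ δ * (R.card * (μ.real E - v 0 0)) := by
    refine mul_le_mul_of_nonneg_left ?_ hδ
    rw [hR]
    linarith
  rw [h5, h3]
  linarith

end Joining

/-! ### Equidistribution of translates -/

/-- A nonempty set that is stable under a family of linear isometries of a Hilbert space has a
common fixed point in its closed convex hull, namely the point of least norm. -/
lemma exists_fixed_mem_closure_convexHull {H ι : Type*} [NormedAddCommGroup H]
    [InnerProductSpace ℝ H] [CompleteSpace H] (U : ι → H →ₗᵢ[ℝ] H) {S : Set H} (hne : S.Nonempty)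
    (hS : ∀ i, ∀ x ∈ S, U i x ∈ S) :
    ∃ f ∈ closure (convexHull ℝ S), ∀ i, U i f = f := by
  have hconv : Convex ℝ (closure (convexHull ℝ S)) := (convex_convexHull ℝ S).closure
  obtain ⟨f, hf, hmin⟩ := exists_norm_eq_iInf_of_complete_convex
    (hne.mono ((subset_convexHull ℝ S).trans subset_closure)) isClosed_closure.isComplete hconv 0
  rw [norm_eq_iInf_iff_real_inner_le_zero hconv hf] at hmin
  refine ⟨f, hf, fun i => ?_⟩
  have hmaps : Set.MapsTo (U i) (closure (convexHull ℝ S)) (closure (convexHull ℝ S)) := by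
    refine Set.MapsTo.closure ?_ (U i).continuous
    have h1 : convexHull ℝ S ⊆ (U i).toLinearMap ⁻¹' convexHull ℝ S :=
      convexHull_min (fun x hx => subset_convexHull ℝ S (hS i x hx))
        ((convex_convexHull ℝ S).linear_preimage _)
    exact fun x hx => h1 hx
  have h1 := hmin (U i f) (hmaps hf)
  have h2 : ‖U i f - f‖ ^ 2 ≤ 0 := by
    rw [norm_sub_sq_real, (U i).norm_map, real_inner_comm]
    rw [zero_sub, inner_neg_left, inner_sub_right, real_inner_self_eq_norm_sq] at h1
    linarith
  exact sub_eq_zero.1 (norm_eq_zero.1 (pow_eq_zero_iff two_ne_zero |>.1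
    (le_antisymm h2 (sq_nonneg _))))

section

variable {G X : Type*} [AddCommGroup G] [AddAction G X] [m : MeasurableSpace X]

/-- Disjoint towers whose unions of levels approximate every measurable set. In contrast to the
partitions in `IsRankOne`, the complement of the tower is not used for the approximation. -/
structure IsTowerSeq (μ : Measure X) (R : ℕ → Finset G) (E : ℕ → Set X) : Prop where
  meas : ∀ j, MeasurableSet (E j)
  disj : ∀ j, (R j : Set G).PairwiseDisjoint fun a => a +ᵥ E j
  approx : ∀ A : Set X, MeasurableSet A → ∃ P : ℕ → Finset G, (∀ j, P j ⊆ R j) ∧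
    Tendsto (fun j => μ.real (symmDiff A (tower (P j) (E j)))) atTop (𝓝 0)

variable [MeasurableConstVAdd G X]
  {μ : Measure X} [VAddInvariantMeasure G X μ] [IsProbabilityMeasure μ]
  {R : ℕ → Finset G} {E : ℕ → Set X}

omit [MeasurableConstVAdd G X] [VAddInvariantMeasure G X μ] in
lemma IsTowerSeq.tendsto_tower (h : IsTowerSeq μ R E) :
    Tendsto (fun j => μ.real (tower (R j) (E j))) atTop (𝓝 1) := by
  obtain ⟨P, hP, hlim⟩ := h.approx Set.univ MeasurableSet.univ
  have h1 : Tendsto (fun j => 1 - μ.real (symmDiff Set.univ (tower (P j) (E j)))) atTop (𝓝 1) := by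
    simpa using hlim.const_sub 1
  refine tendsto_of_tendsto_of_tendsto_of_le_of_le h1 tendsto_const_nhds (fun j => ?_)
    (fun j => measureReal_le_one)
  have h2 := measureReal_le_add_symmDiff μ Set.univ (tower (P j) (E j))
  have h3 : μ.real (tower (P j) (E j)) ≤ μ.real (tower (R j) (E j)) :=
    measureReal_mono (tower_mono (hP j) _)
  rw [probReal_univ] at h2
  change 1 - _ ≤ _
  linarith

omit [MeasurableConstVAdd G X] [VAddInvariantMeasure G X μ] in
lemma tendsto_measure_of_symmDiff {A : Set X} {P : ℕ → Finset G}
    (hlim : Tendsto (fun j => μ.real (symmDiff A (tower (P j) (E j)))) atTop (𝓝 0)) :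
    Tendsto (fun j => μ.real (tower (P j) (E j))) atTop (𝓝 (μ.real A)) := by
  refine tendsto_iff_dist_tendsto_zero.2 (squeeze_zero (fun _ => dist_nonneg) (fun j => ?_) hlim)
  rw [Real.dist_eq, abs_le]
  have h1 := measureReal_le_add_symmDiff μ A (tower (P j) (E j))
  have h2 := measureReal_le_add_symmDiff μ (tower (P j) (E j)) A
  rw [symmDiff_comm] at h2
  constructor <;> linarith

variable (μ) in
/-- The indicator function of a measurable set as an element of `L²`. -/
noncomputable def ind {A : Set X} (hA : MeasurableSet A) : Lp ℝ 2 μ :=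
  indicatorConstLp 2 hA (measure_ne_top μ A) 1

variable (μ) in
/-- The Koopman operator `f ↦ f ∘ T_{-g}` on `L²`, which maps the indicator of `A` to that of
`T_g A`. -/
noncomputable def koopman (g : G) : Lp ℝ 2 μ →ₗᵢ[ℝ] Lp ℝ 2 μ :=
  Lp.compMeasurePreservingₗᵢ ℝ (fun x => -g +ᵥ x) (measurePreserving_vadd (-g) μ)

lemma ind_congr {A B : Set X} (hA : MeasurableSet A) (hB : MeasurableSet B) (h : A = B) :
    ind μ hA = ind μ hB := by subst h; rfl

lemma koopman_ind (g : G) {A : Set X} (hA : MeasurableSet A) :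
    koopman μ g (ind μ hA) = ind μ (hA.const_vadd g) := by
  change ind μ (hA.preimage (measurePreserving_vadd (-g) μ).measurable) = _
  exact ind_congr _ _ (by simp [Set.preimage_vadd])

/-- An invariant square-integrable function has the same integral over all levels of a tower;
since unions of levels approximate every measurable set, it is uncorrelated with every such set. -/
lemma IsTowerSeq.inner_ind_of_invariant (h : IsTowerSeq μ R E) {f : Lp ℝ 2 μ}
    (hf : ∀ g : G, koopman μ g f = f) {A : Set X} (hA : MeasurableSet A) :
    inner ℝ (ind μ hA) f = μ.real A * inner ℝ (ind μ MeasurableSet.univ) f := by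
  have hlevel : ∀ (g : G) {B : Set X} (hB : MeasurableSet B),
      ∫ x in g +ᵥ B, f x ∂μ = ∫ x in B, f x ∂μ := by
    intro g B hB
    rw [← L2.inner_indicatorConstLp_one (𝕜 := ℝ) hB (measure_ne_top μ B),
      ← L2.inner_indicatorConstLp_one (𝕜 := ℝ) (hB.const_vadd g) (measure_ne_top μ _)]
    change inner ℝ (ind μ (hB.const_vadd g)) f = inner ℝ (ind μ hB) f
    rw [← koopman_ind g hB, ← (koopman μ g).inner_map_map (ind μ hB) f, hf]
  have htower : ∀ j, ∀ P ⊆ R j, inner ℝ (ind μ (measurableSet_tower P (h.meas j))) f =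
      P.card * ∫ x in E j, f x ∂μ := by
    intro j P hP
    rw [ind, L2.inner_indicatorConstLp_one, tower, integral_biUnion_finset P
      (fun a _ => (h.meas j).const_vadd a) ((h.disj j).subset (by exact_mod_cast hP))
      (fun a _ => integrableOn_Lp_of_measure_ne_top f (by norm_num) (measure_ne_top μ _))]
    simp [hlevel _ (h.meas j)]
  have hlim : ∀ {B : Set X} (hB : MeasurableSet B) {P : ℕ → Finset G},
      Tendsto (fun j => μ.real (symmDiff B (tower (P j) (E j)))) atTop (𝓝 0) →
      Tendsto (fun j => inner ℝ (ind μ (measurableSet_tower (P j) (h.meas j))) f) atTop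
        (𝓝 (inner ℝ (ind μ hB) f)) := by
    intro B hB P hP
    refine Tendsto.inner ?_ tendsto_const_nhds
    refine tendsto_indicatorConstLp_set (by norm_num) ?_
    rw [← ENNReal.tendsto_toReal_iff (fun _ => measure_ne_top _ _) (by simp)]
    simpa [symmDiff_comm, measureReal_def] using hP
  obtain ⟨P, hP, hPlim⟩ := h.approx A hA
  have hRlim : Tendsto (fun j => μ.real (symmDiff Set.univ (tower (R j) (E j)))) atTop (𝓝 0) := by
    have := h.tendsto_tower.const_sub 1
    rw [sub_self] at this
    refine this.congr fun j => ?_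
    rw [← probReal_compl_eq_one_sub (measurableSet_tower _ (h.meas j))]
    congr 1
    ext x; simp [Set.mem_symmDiff]
  have h1 := (hlim hA hPlim).mul h.tendsto_tower
  have h2 := (tendsto_measure_of_symmDiff hPlim).mul (hlim MeasurableSet.univ hRlim)
  rw [mul_one] at h1
  refine tendsto_nhds_unique h1 (h2.congr fun j => ?_)
  rw [htower j _ (hP j), htower j _ subset_rfl, measureReal_tower μ (h.meas j) (h.disj j) (hP j),
    measureReal_tower μ (h.meas j) (h.disj j) subset_rfl]
  ring

/-- A form of the mean ergodic theorem: some convex combination of translates of `C` is almost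
uncorrelated with all measurable sets at once. -/
lemma IsTowerSeq.exists_average (h : IsTowerSeq μ R E) {C : Set X} (hC : MeasurableSet C) {ε : ℝ}
    (hε : 0 < ε) :
    ∃ (ι : Type) (_ : Fintype ι) (w : ι → ℝ) (g : ι → G), (∀ i, 0 ≤ w i) ∧ ∑ i, w i = 1 ∧
      ∀ D : Set X, MeasurableSet D →
        μ.real D * μ.real C - ε ≤ ∑ i, w i * μ.real (D ∩ (g i +ᵥ C)) := by
  obtain ⟨f, hf, hinv⟩ := exists_fixed_mem_closure_convexHull (koopman (G := G) μ)
    (S := Set.range fun g : G => ind μ (hC.const_vadd g)) (Set.range_nonempty _) (by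
      rintro g _ ⟨g', rfl⟩
      exact ⟨g + g', by rw [koopman_ind]; exact ind_congr _ _ (by rw [vadd_vadd])⟩)
  have hind : ∀ {A B : Set X} (hA : MeasurableSet A) (hB : MeasurableSet B),
      inner ℝ (ind μ hA) (ind μ hB) = μ.real (A ∩ B) := fun hA hB =>
    L2.inner_indicatorConstLp_one_indicatorConstLp_one hA hB
  have hone : inner ℝ (ind μ MeasurableSet.univ) f = μ.real C := by
    have hcl : IsClosed {y : Lp ℝ 2 μ | inner ℝ (ind μ MeasurableSet.univ) y = μ.real C} :=
      isClosed_eq (by fun_prop) continuous_const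
    have hcv : Convex ℝ {y : Lp ℝ 2 μ | inner ℝ (ind μ MeasurableSet.univ) y = μ.real C} :=
      convex_hyperplane (innerSL ℝ (ind μ MeasurableSet.univ)).toLinearMap.isLinear _
    refine closure_minimal (convexHull_min ?_ hcv) hcl hf
    rintro _ ⟨g, rfl⟩
    change inner ℝ _ (ind μ _) = _
    rw [hind, Set.univ_inter, measureReal_vadd]
  obtain ⟨y, hy, hyf⟩ := Metric.mem_closure_iff.1 hf ε hε
  obtain ⟨ι, hι, w, z, hw0, hw1, hz, rfl⟩ := mem_convexHull_iff_exists_fintype.1 hy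
  choose g hg using hz
  refine ⟨ι, hι, w, g, hw0, hw1, fun D hD => ?_⟩
  have h1 : ∑ i, w i * μ.real (D ∩ (g i +ᵥ C)) = inner ℝ (ind μ hD) (∑ i, w i • z i) := by
    rw [inner_sum]
    refine Finset.sum_congr rfl fun i _ => ?_
    rw [inner_smul_right, ← hg i, hind]
  have h2 : μ.real D * μ.real C = inner ℝ (ind μ hD) f := by
    rw [h.inner_ind_of_invariant hinv hD, hone]
  have h3 : inner ℝ (ind μ hD) f - inner ℝ (ind μ hD) (∑ i, w i • z i) ≤ ε := by
    rw [← inner_sub_right]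
    refine (real_inner_le_norm _ _).trans ?_
    have h4 : ‖ind μ hD‖ ≤ 1 := by
      rw [ind, norm_indicatorConstLp (by norm_num) (by norm_num)]
      simpa using Real.rpow_le_one measureReal_nonneg measureReal_le_one (by norm_num)
    rw [dist_eq_norm] at hyf
    exact (mul_le_of_le_one_left (norm_nonneg _) h4).trans hyf.le
  linarith

end

/-! ### The relatively independent joining over a factor -/

open ProbabilityTheory

section

variable {X : Type*} {F : MeasurableSpace X} [m : MeasurableSpace X] [StandardBorelSpace X]
  (μ : Measure X) [IsProbabilityMeasure μ]

/-- The relatively independent self-joining `∫ μ_x × μ_x dμ(x)` of `μ` over a sub-σ-algebra `F`,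
where `x ↦ μ_x` is the disintegration of `μ` over `F`. -/
noncomputable def relIndepJoining (hle : F ≤ m) : Measure (X × X) :=
  let κ : Kernel X X := (condExpKernel μ F).comap id (measurable_id'' hle)
  (κ ×ₖ κ) ∘ₘ μ

instance (hle : F ≤ m) : IsProbabilityMeasure (relIndepJoining μ hle) := by
  unfold relIndepJoining
  infer_instance

lemma relIndepJoining_real_prod (hle : F ≤ m) {A B : Set X} (hA : MeasurableSet A)
    (hB : MeasurableSet B) :
    (relIndepJoining μ hle).real (A ×ˢ B) =
      ∫ x, (condExpKernel μ F x).real A * (condExpKernel μ F x).real B ∂μ := by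
  have hmeas : ∀ {S : Set X}, MeasurableSet S → Measurable fun x => condExpKernel μ F x S :=
    fun hS => (measurable_condExpKernel hS).mono hle le_rfl
  simp_rw [measureReal_def, ← ENNReal.toReal_mul]
  rw [integral_toReal (f := fun x => condExpKernel μ F x A * condExpKernel μ F x B)
      ((hmeas hA).mul (hmeas hB)).aemeasurable
    (ae_of_all _ fun x => ENNReal.mul_lt_top (measure_lt_top _ _) (measure_lt_top _ _)),
    relIndepJoining, Measure.bind_apply (hA.prod hB) (Kernel.aemeasurable _)]
  simp_rw [Kernel.prod_apply_prod]
  rfl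

lemma setIntegral_condExpKernel_real (hle : F ≤ m) {A S : Set X} (hA : MeasurableSet A)
    (hS : MeasurableSet[F] S) :
    ∫ x in S, (condExpKernel μ F x).real A ∂μ = μ.real (S ∩ A) := by
  rw [integral_congr_ae (ae_restrict_of_ae (condExpKernel_ae_eq_condExp hle hA)),
    setIntegral_condExp hle ((integrable_const (1 : ℝ)).indicator hA) hS,
    setIntegral_indicator hA]
  simp

/-- The disintegration over `F` gives mass one or zero to the sets of `F`. -/
lemma condExpKernel_real_ae_eq_indicator (hle : F ≤ m) {A : Set X} (hA : MeasurableSet[F] A) :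
    (fun x => (condExpKernel μ F x).real A) =ᵐ[μ] A.indicator fun _ => 1 := by
  refine (condExpKernel_ae_eq_condExp hle (hle _ hA)).trans ?_
  rw [condExp_of_stronglyMeasurable hle (stronglyMeasurable_const.indicator hA)
    ((integrable_const (1 : ℝ)).indicator (hle _ hA))]

lemma relIndepJoining_prod_compl_eq_zero (hle : F ≤ m) {C B : Set X} (hC : MeasurableSet[F] C)
    (hB : MeasurableSet[F] B) (h : C ⊆ B) : (relIndepJoining μ hle).real (C ×ˢ Bᶜ) = 0 := by
  rw [relIndepJoining_real_prod μ hle (hle _ hC) (hle _ hB).compl]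
  refine integral_eq_zero_of_ae ?_
  filter_upwards [condExpKernel_real_ae_eq_indicator μ hle hC,
    condExpKernel_real_ae_eq_indicator μ hle hB.compl] with x h1 h2
  rw [h1, h2]
  by_cases hx : x ∈ C
  · simp [h hx]
  · simp [hx]

/-- If the relatively independent joining vanishes on `A × Aᶜ`, then the conditional probability
of `A` takes only the values zero and one, so that `A` belongs to `F` up to a null set. -/
lemma exists_ae_eq_of_relIndepJoining_eq_zero (hle : F ≤ m) {A : Set X} (hA : MeasurableSet A)
    (h : (relIndepJoining μ hle).real (A ×ˢ Aᶜ) = 0) :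
    ∃ B, MeasurableSet[F] B ∧ A =ᵐ[μ] B := by
  set e : X → ℝ := fun x => (condExpKernel μ F x).real A with he
  have heF : Measurable[F] e := (measurable_condExpKernel hA).ennreal_toReal
  have hem : Measurable e := heF.mono hle le_rfl
  have he0 : ∀ x, 0 ≤ e x := fun x => measureReal_nonneg
  have he1 : ∀ x, e x ≤ 1 := fun x => measureReal_le_one
  have hint : Integrable e μ := integrable_toReal_condExpKernel hA
  have hz : ∀ᵐ x ∂μ, e x * (1 - e x) = 0 := by
    rw [relIndepJoining_real_prod μ hle hA hA.compl] at h
    simp_rw [probReal_compl_eq_one_sub hA] at h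
    refine (integral_eq_zero_iff_of_nonneg (fun x => mul_nonneg (he0 x)
      (sub_nonneg.2 (he1 x))) ?_).1 h
    refine Integrable.of_bound (hem.mul (measurable_const.sub hem)).aestronglyMeasurable 1
      (ae_of_all _ fun x => ?_)
    rw [Real.norm_of_nonneg (mul_nonneg (he0 x) (sub_nonneg.2 (he1 x)))]
    exact mul_le_one₀ (he1 x) (sub_nonneg.2 (he1 x)) (by linarith [he0 x])
  have hB : MeasurableSet[F] {x | e x = 1} := heF (measurableSet_singleton (1 : ℝ))
  refine ⟨{x | e x = 1}, hB, ?_⟩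
  have h1 : μ.real ({x | e x = 1}ᶜ ∩ A) = 0 := by
    rw [← setIntegral_condExpKernel_real μ hle hA hB.compl]
    refine integral_eq_zero_of_ae ?_
    rw [Filter.EventuallyEq, ae_restrict_iff' (hle _ hB.compl)]
    filter_upwards [hz] with x hx hx1
    rcases mul_eq_zero.1 hx with h | h
    · exact h
    · exact absurd (by linarith : e x = 1) hx1
  have h2 : μ.real ({x | e x = 1} ∩ A) = μ.real {x | e x = 1} := by
    rw [← setIntegral_condExpKernel_real μ hle hA hB,
      setIntegral_congr_fun (g := fun _ => (1 : ℝ)) (hle _ hB) (fun x hx => hx)]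
    simp
  have h3 : μ.real ({x | e x = 1} \ A) = 0 := by
    have := measureReal_inter_add_sdiff (μ := μ) (s := {x | e x = 1}) hA
    linarith
  rw [← measure_symmDiff_eq_zero_iff, Set.symmDiff_def]
  rw [measureReal_eq_zero_iff] at h1 h3
  refine measure_union_null ?_ h3
  rwa [Set.sdiff_eq, Set.inter_comm]

variable {n : ℕ} [AddAction (Fin n → ℤ) X] [MeasurableConstVAdd (Fin n → ℤ) X]
  [VAddInvariantMeasure (Fin n → ℤ) X μ]

/-- The disintegration of an invariant measure over a factor is equivariant. -/
lemma IsFactor.condExpKernel_vadd (hF : IsFactor n m F) (g : Fin n → ℤ) {A : Set X}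
    (hA : MeasurableSet A) :
    (fun x => (condExpKernel μ F x).real (g +ᵥ A)) =ᵐ[μ]
      fun x => (condExpKernel μ F (-g +ᵥ x)).real A := by
  refine (condExpKernel_ae_eq_condExp hF.le (hA.const_vadd g)).trans (Filter.EventuallyEq.symm ?_)
  have hmp := measurePreserving_vadd (-g) μ
  have hTF : @Measurable X X F F (fun x => -g +ᵥ x) := by
    intro S hS
    have : (fun x => -g +ᵥ x) ⁻¹' S = g +ᵥ S := by simp [Set.preimage_vadd]
    rw [this]
    exact hF.invariant g S hS
  have heF : Measurable[F] fun x => (condExpKernel μ F (-g +ᵥ x)).real A :=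
    (Measurable.ennreal_toReal (measurable_condExpKernel hA)).comp hTF
  have hint : Integrable (fun x => (condExpKernel μ F (-g +ᵥ x)).real A) μ :=
    hmp.integrable_comp_of_integrable (integrable_toReal_condExpKernel hA)
  refine ae_eq_condExp_of_forall_setIntegral_eq hF.le
    ((integrable_const (1 : ℝ)).indicator (hA.const_vadd g)) (fun S _ _ => hint.integrableOn) ?_
    heF.stronglyMeasurable.aestronglyMeasurable
  intro S hS _
  have hS' : (fun x => -g +ᵥ x) ⁻¹' (-g +ᵥ S) = S := by simp [Set.preimage_vadd]
  have h1 := hmp.setIntegral_preimage_emb (measurableEmbedding_const_vadd (-g))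
    (fun x => (condExpKernel μ F x).real A) (-g +ᵥ S)
  rw [hS'] at h1
  rw [h1, setIntegral_condExpKernel_real μ hF.le hA (hF.invariant _ _ hS),
    setIntegral_indicator (hA.const_vadd g), ← measureReal_vadd μ g, Set.vadd_set_inter]
  simp

lemma IsFactor.isSelfJoining (hF : IsFactor n m F) :
    IsSelfJoining (Fin n → ℤ) μ (relIndepJoining μ hF.le) where
  fst A hA := by
    rw [relIndepJoining_real_prod μ hF.le hA MeasurableSet.univ]
    simpa using setIntegral_condExpKernel_real μ hF.le hA (MeasurableSet.univ (α := X))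
  snd A hA := by
    rw [relIndepJoining_real_prod μ hF.le MeasurableSet.univ hA]
    simpa using setIntegral_condExpKernel_real μ hF.le hA (MeasurableSet.univ (α := X))
  vadd g A B hA hB := by
    rw [relIndepJoining_real_prod μ hF.le (hA.const_vadd g) (hB.const_vadd g),
      relIndepJoining_real_prod μ hF.le hA hB]
    rw [← (measurePreserving_vadd (-g) μ).integral_comp (measurableEmbedding_const_vadd (-g))
      (fun x => (condExpKernel μ F x).real A * (condExpKernel μ F x).real B)]
    refine integral_congr_ae ?_
    filter_upwards [hF.condExpKernel_vadd μ g hA, hF.condExpKernel_vadd μ g hB] with x h1 h2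
    rw [h1, h2]

end

/-! ### Rank-one towers over rectangles -/

/-- A nonatomic probability space is covered by finitely many sets of small measure: it embeds
into the compact Cantor space, every point of which has a neighbourhood of small measure. -/
lemma exists_finite_cover_measureReal_lt {X : Type*} [MeasurableSpace X] [StandardBorelSpace X]
    (μ : Measure X) [IsProbabilityMeasure μ] [NullSingletonClass μ] {ε : ℝ} (hε : 0 < ε) :
    ∃ T : Finset (Set X), (∀ S ∈ T, MeasurableSet S ∧ μ.real S < ε) ∧ ∀ x, ∃ S ∈ T, x ∈ S := by
  classical
  obtain ⟨f, hf, hinj⟩ := MeasurableSpace.measurable_injection_nat_bool_of_countablySeparated X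
  have : IsProbabilityMeasure (μ.map f) := Measure.isProbabilityMeasure_map hf.aemeasurable
  have hnull : ∀ y, (μ.map f) {y} = 0 := by
    intro y
    rw [Measure.map_apply hf (measurableSet_singleton y)]
    exact Set.Subsingleton.measure_zero
      (fun a ha b hb => hinj ((show f a = y from ha).trans (show f b = y from hb).symm)) μ
  have hnhds : ∀ y, ∃ U, y ∈ U ∧ IsOpen U ∧ (μ.map f) U < ENNReal.ofReal ε := by
    intro y
    obtain ⟨U, hyU, hU, hlt⟩ := Set.exists_isOpen_lt_of_lt (μ := μ.map f) {y} (ENNReal.ofReal ε)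
      (by rw [hnull]; simpa using hε)
    exact ⟨U, hyU rfl, hU, hlt⟩
  choose U hyU hU hlt using hnhds
  obtain ⟨t, ht⟩ := isCompact_univ.elim_finite_subcover U hU
    (fun y _ => Set.mem_iUnion.2 ⟨y, hyU y⟩)
  refine ⟨t.image fun y => f ⁻¹' U y, ?_, fun x => ?_⟩
  · intro S hS
    obtain ⟨y, -, rfl⟩ := Finset.mem_image.1 hS
    refine ⟨hf (hU y).measurableSet, ?_⟩
    have := hlt y
    rw [Measure.map_apply hf (hU y).measurableSet] at this
    exact (ENNReal.lt_ofReal_iff_toReal_lt (measure_ne_top _ _)).1 this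
  · obtain ⟨y, hy, hx⟩ := Set.mem_iUnion₂.1 (ht (Set.mem_univ (f x)))
    exact ⟨_, Finset.mem_image_of_mem _ hy, hx⟩

/-- In a nonatomic space, a single element of a sequence of families converging to points has
measure tending to zero: each of finitely many small sets covering the space is approximated by
unions which either contain the element, impossible if it is large, or are disjoint from it. -/
lemma ConvergesToPoints.tendsto_measure_zero {X : Type*} [MeasurableSpace X]
    [StandardBorelSpace X] {μ : Measure X} [IsProbabilityMeasure μ] [NullSingletonClass μ]
    {ξ : ℕ → Set (Set X)} (hξ : ConvergesToPoints μ ξ) {Y : ℕ → Set X}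
    (hY : ∀ j, ∀ S ∈ ξ j, S = Y j ∨ Disjoint (Y j) S) :
    Tendsto (fun j => μ.real (Y j)) atTop (𝓝 0) := by
  refine Metric.tendsto_nhds.2 fun ε hε => ?_
  obtain ⟨T, hT, hcov⟩ := exists_finite_cover_measureReal_lt μ (half_pos hε)
  have hT1 : (0 : ℝ) < T.card + 1 := by positivity
  have hev : ∀ᶠ j in atTop, ∀ S ∈ T, μ.real (Y j) < ε ∨ μ.real (S ∩ Y j) < ε / (T.card + 1) := by
    refine (Finset.eventually_all T).2 fun S hS => ?_
    obtain ⟨A', hA', hlim⟩ := hξ S (hT S hS).1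
    have hlim' : Tendsto (fun j => μ.real (symmDiff S (A' j))) atTop (𝓝 0) := by
      simpa [measureReal_def] using (ENNReal.tendsto_toReal_iff (fun _ => measure_ne_top _ _)
        (by simp)).2 hlim
    filter_upwards [hlim'.eventually (gt_mem_nhds (half_pos hε)),
      hlim'.eventually (gt_mem_nhds (div_pos hε hT1))] with j h1 h2
    obtain ⟨Q, hQ, hA⟩ := hA' j
    by_cases hYQ : Y j ∈ Q
    · left
      have hsub : Y j ⊆ A' j := by rw [hA]; exact Set.subset_sUnion_of_mem hYQ
      have h3 : μ.real (Y j) ≤ μ.real (symmDiff S (A' j)) + μ.real S := by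
        refine (measureReal_mono ?_).trans (measureReal_union_le _ _)
        intro x hx
        by_cases hxS : x ∈ S
        · exact Or.inr hxS
        · exact Or.inl (Or.inr ⟨hsub hx, hxS⟩)
      linarith [(hT S hS).2]
    · right
      refine (measureReal_mono ?_).trans_lt h2
      rintro x ⟨hxS, hxY⟩
      refine Or.inl ⟨hxS, fun hx => ?_⟩
      rw [hA] at hx
      obtain ⟨s, hs, hxs⟩ := hx
      rcases hY j s (hQ hs) with h | h
      · exact hYQ (h ▸ hs)
      · exact Set.disjoint_left.1 h hxY hxs
  filter_upwards [hev] with j hj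
  rw [Real.dist_eq, sub_zero, abs_of_nonneg measureReal_nonneg]
  by_contra hge
  have h1 : μ.real (Y j) ≤ ∑ S ∈ T, μ.real (S ∩ Y j) := by
    refine (measureReal_mono (h₂ := measure_ne_top _ _) ?_).trans
      (measureReal_biUnion_finset_le T _)
    intro x hx
    obtain ⟨S, hS, hxS⟩ := hcov x
    exact Set.mem_biUnion hS ⟨hxS, hx⟩
  have h2 : ∑ S ∈ T, μ.real (S ∩ Y j) ≤ T.card * (ε / (T.card + 1)) := by
    rw [← nsmul_eq_mul]
    exact Finset.sum_le_card_nsmul _ _ _ fun S hS => ((hj S hS).resolve_left hge).le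
  have h3 : T.card * (ε / (T.card + 1)) < ε := by
    rw [mul_div_assoc', div_lt_iff₀ hT1]
    nlinarith
  linarith

/-- The rectangle `rect h` as a finite set. -/
noncomputable def rectFinset {n : ℕ} (h : Fin n → ℕ) : Finset (Fin n → ℤ) :=
  Fintype.piFinset fun i => Finset.Ico (0 : ℤ) (h i)

lemma mem_rectFinset {n : ℕ} {h : Fin n → ℕ} {k : Fin n → ℤ} :
    k ∈ rectFinset h ↔ k ∈ rect h := by
  simp [rectFinset, rect]

/-- A rank-one action has towers over rectangles whose unions of levels approximate all
measurable sets. -/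
lemma IsRankOne.exists_isTowerSeq {n : ℕ} {X : Type*} [m : MeasurableSpace X]
    [StandardBorelSpace X] {μ : Measure X} [IsProbabilityMeasure μ] [NullSingletonClass μ]
    [AddAction (Fin n → ℤ) X] (hT : IsRankOne n μ) :
    ∃ (h : ℕ → Fin n → ℕ) (E : ℕ → Set X), IsTowerSeq μ (fun j => rectFinset (h j)) E := by
  classical
  obtain ⟨h, E, hE, hd, hξ⟩ := hT
  have hcoe : ∀ j, (rectFinset (h j) : Set (Fin n → ℤ)) = rect (h j) := fun j =>
    Set.ext fun k => mem_rectFinset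
  have htow : ∀ j, tower (rectFinset (h j)) (E j) = ⋃ k ∈ rect (h j), (k +ᵥ E j) := by
    intro j
    simp only [tower, mem_rectFinset]
  have hY : Tendsto (fun j => μ.real (tower (rectFinset (h j)) (E j))ᶜ) atTop (𝓝 0) := by
    refine hξ.tendsto_measure_zero fun j S hS => ?_
    rw [htow]
    rcases hS with h1 | ⟨k, hk, rfl⟩
    · exact Or.inl h1
    · exact Or.inr (disjoint_compl_left.mono_right
        (Set.subset_biUnion_of_mem (u := fun k => k +ᵥ E j) hk))
  refine ⟨h, E, hE, fun j => by rw [hcoe]; exact hd j, fun A hA => ?_⟩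
  obtain ⟨A', hA', hlim⟩ := hξ A hA
  have hlim' : Tendsto (fun j => μ.real (symmDiff A (A' j))) atTop (𝓝 0) := by
    simpa [measureReal_def] using (ENNReal.tendsto_toReal_iff (fun _ => measure_ne_top _ _)
      (by simp)).2 hlim
  choose Q hQ hAQ using hA'
  refine ⟨fun j => (rectFinset (h j)).filter fun a => a +ᵥ E j ∈ Q j,
    fun j => Finset.filter_subset _ _, ?_⟩
  have hsum := hlim'.add hY
  rw [add_zero] at hsum
  refine squeeze_zero (fun _ => measureReal_nonneg) (fun j => ?_) hsum
  refine (measureReal_mono ?_).trans (measureReal_union_le _ _)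
  intro x hx
  by_cases hxR : x ∈ tower (rectFinset (h j)) (E j)
  · have hiff : x ∈ A' j ↔
        x ∈ tower ((rectFinset (h j)).filter fun a => a +ᵥ E j ∈ Q j) (E j) := by
      rw [mem_tower, hAQ j]
      constructor
      · rintro ⟨S, hS, hxS⟩
        rcases hQ j hS with h1 | ⟨k, hk, rfl⟩
        · rw [h1, ← htow] at hxS
          exact absurd hxR hxS
        · exact ⟨k, Finset.mem_filter.2 ⟨mem_rectFinset.2 hk, hS⟩, hxS⟩
      · rintro ⟨a, ha, hxa⟩
        exact ⟨_, (Finset.mem_filter.1 ha).2, hxa⟩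
    left
    rw [Set.mem_symmDiff] at hx ⊢
    rwa [hiff]
  · exact Or.inr hxR

/-- The points `a` of `{0, …, h - 1}` for which every difference `k = a - b`, `b < h`, satisfies
`h - |k| ≥ (1/2 - ε) h`. -/
noncomputable def centre (ε : ℝ) (h : ℕ) : Finset ℤ :=
  (Finset.Ico (0 : ℤ) h).filter fun a =>
    (1 / 2 - ε) * h ≤ (h : ℝ) - a ∧ (1 / 2 - ε) * h ≤ (a : ℝ) + 1

lemma le_card_centre {ε : ℝ} (hε : 0 < ε) (hε' : ε < 1 / 2) (h : ℕ) :
    ε * h ≤ (centre ε h).card := by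
  rcases Nat.eq_zero_or_pos h with rfl | hpos
  · simp
  have hh : (0 : ℝ) < h := by exact_mod_cast hpos
  obtain ⟨q, hq1, hq2⟩ : ∃ q : ℕ, 2 * q ≤ h ∧ h ≤ 2 * q + 1 := ⟨h / 2, by omega, by omega⟩
  -- the integers from `q = ⌊h / 2⌋` to `q + ⌊ε h⌋` are central
  have hsub : Finset.Icc (q : ℤ) ((q + ⌊ε * h⌋₊ : ℕ) : ℤ) ⊆ centre ε h := by
    intro a ha
    rw [Finset.mem_Icc] at ha
    have h1 : 2 * (q : ℝ) ≤ h := by exact_mod_cast hq1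
    have h2 : (h : ℝ) ≤ 2 * q + 1 := by exact_mod_cast hq2
    have h3 : (⌊ε * h⌋₊ : ℝ) ≤ ε * h := Nat.floor_le (by positivity)
    have h4 : (q : ℝ) ≤ a := by exact_mod_cast ha.1
    have h5 : (a : ℝ) ≤ q + ⌊ε * h⌋₊ := by exact_mod_cast ha.2
    have h6 : (1 / 2 - ε) * h ≤ (h : ℝ) - a := by linarith
    have h7 : (a : ℝ) < h := by
      have : 0 < (1 / 2 - ε) * h := mul_pos (by linarith) hh
      linarith
    refine Finset.mem_filter.2 ⟨Finset.mem_Ico.2 ⟨(Int.natCast_nonneg _).trans ha.1,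
      by exact_mod_cast h7⟩, h6, ?_⟩
    have : 0 < ε * h := by positivity
    linarith
  have hcard := Finset.card_le_card hsub
  rw [Int.card_Icc] at hcard
  have h8 : ⌊ε * h⌋₊ + 1 ≤ (centre ε h).card := by omega
  have h9 : ε * h < ⌊ε * h⌋₊ + 1 := Nat.lt_floor_add_one _
  have h10 : ((⌊ε * h⌋₊ + 1 : ℕ) : ℝ) ≤ (centre ε h).card := by exact_mod_cast h8
  push_cast at h10
  linarith

lemma le_card_overlap_Ico {ε : ℝ} {h : ℕ} {a b : ℤ} (ha : a ∈ centre ε h)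
    (hb : b ∈ Finset.Ico (0 : ℤ) h) :
    (1 / 2 - ε) * h ≤ (overlap (Finset.Ico (0 : ℤ) h) (a - b)).card := by
  obtain ⟨ha0, ha1, ha2⟩ := Finset.mem_filter.1 ha
  rw [Finset.mem_Ico] at ha0 hb
  have heq : overlap (Finset.Ico (0 : ℤ) h) (a - b) =
      Finset.Ico (max 0 (a - b)) (min h (h + (a - b))) := by
    ext c
    simp only [overlap, Finset.mem_filter, Finset.mem_Ico]
    omega
  rw [heq, Int.card_Ico]
  have h1 : (h : ℤ) - a ≤ (min (h : ℤ) (h + (a - b)) - max 0 (a - b)).toNat ∨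
      a + 1 ≤ (min (h : ℤ) (h + (a - b)) - max 0 (a - b)).toNat := by omega
  rcases h1 with h1 | h1
  · refine ha1.trans ?_
    exact_mod_cast h1
  · refine ha2.trans ?_
    exact_mod_cast h1

/-- A fixed proportion of any rectangle `R` consists of central points `a`, for which all the
overlaps `R ∩ (R + (a - b))`, `b ∈ R`, have at least about `|R| / 2ⁿ` elements. -/
lemma exists_centre_rectFinset {n : ℕ} {ε : ℝ} (hε : 0 < ε) (hε' : ε < 1 / 2) (h : Fin n → ℕ) :
    ∃ C ⊆ rectFinset h, ε ^ n * (rectFinset h).card ≤ C.card ∧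
      ∀ a ∈ C, ∀ b ∈ rectFinset h,
        (1 / 2 - ε) ^ n * (rectFinset h).card ≤ (overlap (rectFinset h) (a - b)).card := by
  have hcard : ((rectFinset h).card : ℝ) = ∏ i, (h i : ℝ) := by
    simp [rectFinset, Fintype.card_piFinset]
  have hpow : ∀ c : ℝ, c ^ n * ((rectFinset h).card : ℝ) = ∏ i, c * (h i : ℝ) := by
    intro c
    rw [hcard, Finset.prod_mul_distrib]
    simp
  refine ⟨Fintype.piFinset fun i => centre ε (h i), Fintype.piFinset_subset _ _ fun i =>
    Finset.filter_subset _ _, ?_, fun a ha b hb => ?_⟩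
  · rw [hpow, Fintype.card_piFinset, Nat.cast_prod]
    exact Finset.prod_le_prod (fun i _ => by positivity) fun i _ => le_card_centre hε hε' _
  · have heq : overlap (rectFinset h) (a - b) =
        Fintype.piFinset fun i => overlap (Finset.Ico (0 : ℤ) (h i)) (a i - b i) := by
      ext c
      simp only [overlap, rectFinset, Finset.mem_filter, Fintype.mem_piFinset, Pi.sub_apply]
      exact forall_and.symm
    rw [heq, hpow, Fintype.card_piFinset, Nat.cast_prod]
    rw [Fintype.mem_piFinset] at ha
    rw [rectFinset, Fintype.mem_piFinset] at hb
    exact Finset.prod_le_prod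
      (fun i _ => mul_nonneg (by linarith) (Nat.cast_nonneg _))
      fun i _ => le_card_overlap_Ico (ha i) (hb i)

/-! ### Partial rigidity for finite families -/

section

variable {G X : Type*} [AddCommGroup G] [DecidableEq G] [AddAction G X] [m : MeasurableSpace X]
  [MeasurableConstVAdd G X] {μ : Measure X} [VAddInvariantMeasure G X μ] [IsProbabilityMeasure μ]

omit [DecidableEq G] [MeasurableConstVAdd G X] in
/-- If the part of `(A ∩ B) × Bᶜ` on the `k`-th off-diagonal over `D` is small on average over
translates by `g s`, and the translates of `A ∩ B` are equidistributed with respect to `D`, then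
`A ∩ T_k B` is not much smaller than `D` and `A ∩ B` require. -/
lemma le_measureReal_inter_vadd {κ : Type*} [Fintype κ] {w : κ → ℝ} {g : κ → G}
    (hw0 : ∀ s, 0 ≤ w s) (hw1 : ∑ s, w s = 1) {D A B : Set X} {k : G} {x y : ℝ}
    (hx : x ≤ ∑ s, w s * μ.real (D ∩ (g s +ᵥ (A ∩ B))))
    (hy : ∑ s, w s * μ.real (D ∩ ((g s +ᵥ (A ∩ B)) ∩ (k +ᵥ (g s +ᵥ Bᶜ)))) ≤ y) :
    x - y ≤ μ.real (A ∩ (k +ᵥ B)) := by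
  have h1 : ∀ s, μ.real (D ∩ (g s +ᵥ (A ∩ B))) ≤ μ.real (A ∩ (k +ᵥ B)) +
      μ.real (D ∩ ((g s +ᵥ (A ∩ B)) ∩ (k +ᵥ (g s +ᵥ Bᶜ)))) := by
    intro s
    rw [← measureReal_vadd μ (g s) (A ∩ (k +ᵥ B))]
    refine (measureReal_mono ?_).trans (measureReal_union_le _ _)
    rintro _ ⟨hD, z, hz, rfl⟩
    by_cases hzB : z ∈ k +ᵥ B
    · exact Or.inl ⟨z, ⟨hz.1, hzB⟩, rfl⟩
    · refine Or.inr ⟨hD, ⟨z, hz, rfl⟩, ?_⟩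
      rw [vadd_vadd, add_comm, ← vadd_vadd]
      refine ⟨z, ?_, rfl⟩
      rwa [Set.vadd_set_compl]
  have h2 : ∑ s, w s * μ.real (D ∩ (g s +ᵥ (A ∩ B))) ≤ ∑ s, (w s * μ.real (A ∩ (k +ᵥ B)) +
      w s * μ.real (D ∩ ((g s +ᵥ (A ∩ B)) ∩ (k +ᵥ (g s +ᵥ Bᶜ))))) :=
    Finset.sum_le_sum fun s _ => by
      rw [← mul_add]; exact mul_le_mul_of_nonneg_left (h1 s) (hw0 s)
  rw [Finset.sum_add_distrib, ← Finset.sum_mul, hw1, one_mul] at h2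
  linarith

/-- The heart of the argument. A joining that is not concentrated on the diagonal charges
off-diagonal pairs of levels with central first member. As it vanishes on the translates of
`(A i ∩ B i) × (B i)ᶜ`, one of the corresponding off-diagonals nearly avoids these sets. -/
lemma IsTowerSeq.exists_ne_zero_le {R : ℕ → Finset G} {E : ℕ → Set X} (h : IsTowerSeq μ R E)
    {δ c : ℝ} (hδ : 0 < δ)
    (hcentre : ∀ j, ∃ C ⊆ R j, δ * (R j).card ≤ C.card ∧
      ∀ a ∈ C, ∀ b ∈ R j, c * (R j).card ≤ (overlap (R j) (a - b)).card)
    {ν : Measure (X × X)} [IsProbabilityMeasure ν] (hν : IsSelfJoining G μ ν) {A₀ : Set X}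
    (hA₀ : MeasurableSet A₀) (hpos : 0 < ν.real (A₀ ×ˢ A₀ᶜ)) {ι : Type*} [Fintype ι]
    {A B : ι → Set X} (hA : ∀ i, MeasurableSet (A i)) (hB : ∀ i, MeasurableSet (B i))
    (hzero : ∀ i, ν.real ((A i ∩ B i) ×ˢ (B i)ᶜ) = 0) {ε : ℝ} (hε : 0 < ε) :
    ∃ k ≠ (0 : G), ∀ i, c * μ.real (A i ∩ B i) - ε ≤ μ.real (A i ∩ (k +ᵥ B i)) := by
  have hC : ∀ i, MeasurableSet (A i ∩ B i) := fun i => (hA i).inter (hB i)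
  have hε3 : 0 < ε / 3 := by positivity
  choose κ hκ w g hw0 hw1 hav using fun i => h.exists_average (hC i) hε3
  choose P hPR hP using fun i (s : κ i) => h.approx _ ((hC i).const_vadd (g i s))
  choose Q hQR hQ using fun i (s : κ i) => h.approx _ ((hB i).compl.const_vadd (g i s))
  obtain ⟨P₀, hP₀R, hP₀⟩ := h.approx A₀ hA₀
  let err : ℕ → ℝ := fun j => ∑ i, ∑ s, w i s *
    (2 * (μ.real (symmDiff (g i s +ᵥ (A i ∩ B i)) (tower (P i s j) (E j))) +
      μ.real (symmDiff (g i s +ᵥ (B i)ᶜ) (tower (Q i s j) (E j)))))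
  have herr : Tendsto err atTop (𝓝 0) := by
    have : Tendsto err atTop (𝓝 (∑ i, ∑ s, w i s * (2 * (0 + 0)))) :=
      tendsto_finsetSum _ fun i _ => tendsto_finsetSum _ fun s _ =>
        (((hP i s).add (hQ i s)).const_mul 2).const_mul (w i s)
    simpa using this
  let mass : ℕ → ℝ := fun j => δ * (μ.real (tower (R j) (E j)) - 1 + ν.real (A₀ ×ˢ A₀ᶜ) -
    2 * μ.real (symmDiff A₀ (tower (P₀ j) (E j)))) - (1 - μ.real (tower (R j) (E j)))
  have hmass : Tendsto mass atTop (𝓝 (δ * ν.real (A₀ ×ˢ A₀ᶜ))) := by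
    have := ((((h.tendsto_tower.sub_const 1).add_const (ν.real (A₀ ×ˢ A₀ᶜ))).sub
      (hP₀.const_mul 2)).const_mul δ).sub (h.tendsto_tower.const_sub 1)
    simpa using this
  have hev1 : ∀ᶠ j in atTop, err j < ε / 3 * mass j := by
    refine herr.eventually_lt (hmass.const_mul (ε / 3)) ?_
    positivity
  have hev2 : ∀ᶠ j in atTop, c - ε / 3 < c * μ.real (tower (R j) (E j)) := by
    have := h.tendsto_tower.const_mul c
    rw [mul_one] at this
    exact this.eventually (lt_mem_nhds (by linarith))
  obtain ⟨j, hj1, hj2⟩ := (hev1.and hev2).exists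
  obtain ⟨C, hCR, hcard, hover⟩ := hcentre j
  have hE := h.meas j
  have hd := h.disj j
  set v : G → G → ℝ := fun a b => ν.real ((a +ᵥ E j) ×ˢ (b +ᵥ E j)) with hv
  have hv0 : ∀ a b, 0 ≤ v a b := fun a b => measureReal_nonneg
  let β : ι → G → ℝ := fun i k => ∑ s, w i s * μ.real (tower (overlap (R j) k) (E j) ∩
    ((g i s +ᵥ (A i ∩ B i)) ∩ (k +ᵥ (g i s +ᵥ (B i)ᶜ))))
  have hβ0 : ∀ i k, 0 ≤ β i k := fun i k =>
    Finset.sum_nonneg fun s _ => mul_nonneg (hw0 i s) measureReal_nonneg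
  have hsum : ∑ a ∈ R j, ∑ b ∈ R j, v a b * ∑ i, β i (a - b) ≤ err j := by
    have h1 : ∑ a ∈ R j, ∑ b ∈ R j, v a b * ∑ i, β i (a - b) = ∑ i, ∑ s, w i s *
        ∑ a ∈ R j, ∑ b ∈ R j, v a b * μ.real (tower (overlap (R j) (a - b)) (E j) ∩
          ((g i s +ᵥ (A i ∩ B i)) ∩ ((a - b) +ᵥ (g i s +ᵥ (B i)ᶜ)))) := by
      simp only [β, Finset.mul_sum]
      rw [Finset.sum_congr rfl fun a _ => Finset.sum_comm, Finset.sum_comm]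
      refine Finset.sum_congr rfl fun i _ => ?_
      rw [Finset.sum_congr rfl fun a _ => Finset.sum_comm, Finset.sum_comm]
      refine Finset.sum_congr rfl fun s _ => Finset.sum_congr rfl fun a _ =>
        Finset.sum_congr rfl fun b _ => ?_
      ring
    rw [h1]
    refine Finset.sum_le_sum fun i _ => Finset.sum_le_sum fun s _ =>
      mul_le_mul_of_nonneg_left ?_ (hw0 i s)
    have h2 := hν.sum_overlap_le hE hd (hPR i s j) (hQR i s j) ((hC i).const_vadd (g i s))
      ((hB i).compl.const_vadd (g i s))
    rwa [hν.vadd _ _ _ (hC i) (hB i).compl, hzero, zero_add] at h2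
  have hmassle : mass j ≤ ∑ a ∈ C, ∑ b ∈ (R j).erase a, v a b :=
    hν.le_sum_ne hE hd (hP₀R j) hA₀ hδ.le hCR hcard
  obtain ⟨a, ha, b, hb, hab⟩ : ∃ a ∈ C, ∃ b ∈ (R j).erase a, ∑ i, β i (a - b) ≤ ε / 3 := by
    by_contra! hcon
    have h1 : ε / 3 * ∑ a ∈ C, ∑ b ∈ (R j).erase a, v a b ≤
        ∑ a ∈ C, ∑ b ∈ (R j).erase a, v a b * ∑ i, β i (a - b) := by
      simp only [Finset.mul_sum (Finset.univ), Finset.mul_sum C, Finset.mul_sum ((R j).erase _)]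
      refine Finset.sum_le_sum fun a ha => Finset.sum_le_sum fun b hb => ?_
      rw [← Finset.mul_sum, mul_comm]
      exact mul_le_mul_of_nonneg_left (hcon a ha b hb).le (hv0 a b)
    have h0 : ∀ a b, 0 ≤ v a b * ∑ i, β i (a - b) := fun a b =>
      mul_nonneg (hv0 a b) (Finset.sum_nonneg fun i _ => hβ0 i _)
    have h2 : ∑ a ∈ C, ∑ b ∈ (R j).erase a, v a b * ∑ i, β i (a - b) ≤
        ∑ a ∈ R j, ∑ b ∈ R j, v a b * ∑ i, β i (a - b) :=
      (Finset.sum_le_sum fun a _ => Finset.sum_le_sum_of_subset_of_nonneg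
        (Finset.erase_subset _ _) fun b _ _ => h0 a b).trans
      (Finset.sum_le_sum_of_subset_of_nonneg hCR fun a _ _ => Finset.sum_nonneg fun b _ => h0 a b)
    have h3 := mul_le_mul_of_nonneg_left hmassle hε3.le
    linarith
  rw [Finset.mem_erase] at hb
  refine ⟨a - b, sub_ne_zero.2 (Ne.symm hb.1), fun i => ?_⟩
  have hβi : β i (a - b) ≤ ε / 3 :=
    (Finset.single_le_sum (fun i _ => hβ0 i (a - b)) (Finset.mem_univ i)).trans hab
  have h4 := le_measureReal_inter_vadd (hw0 i) (hw1 i)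
    (hav i _ (measurableSet_tower (overlap (R j) (a - b)) hE)) hβi
  have h5 : c - ε / 3 ≤ μ.real (tower (overlap (R j) (a - b)) (E j)) := by
    refine hj2.le.trans ?_
    rw [measureReal_tower μ hE hd subset_rfl, measureReal_tower μ hE hd (overlap_subset _ _),
      ← mul_assoc]
    exact mul_le_mul_of_nonneg_right (hover a ha b hb.2) measureReal_nonneg
  have h6 : (c - ε / 3) * μ.real (A i ∩ B i) ≤
      μ.real (tower (overlap (R j) (a - b)) (E j)) * μ.real (A i ∩ B i) :=
    mul_le_mul_of_nonneg_right h5 measureReal_nonneg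
  have h7 : ε / 3 * μ.real (A i ∩ B i) ≤ ε / 3 :=
    mul_le_of_le_one_right hε3.le measureReal_le_one
  linarith

end

section

variable {n : ℕ} {X : Type*} {F : MeasurableSpace X} [m : MeasurableSpace X]
  [StandardBorelSpace X] {μ : Measure X} [IsProbabilityMeasure μ] [NullSingletonClass μ]
  [AddAction (Fin n → ℤ) X] [MeasurableConstVAdd (Fin n → ℤ) X]
  [VAddInvariantMeasure (Fin n → ℤ) X μ]

/-- Partial rigidity of a proper factor for finitely many sets, up to an error, along a nonzero
element of `ℤⁿ`. -/
lemma IsRankOne.exists_ne_zero_le (hT : IsRankOne n μ) (hF : IsFactor n m F)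
    (hprop : IsProper μ F) {ι : Type*} [Fintype ι] {A B : ι → Set X}
    (hA : ∀ i, MeasurableSet[F] (A i)) (hB : ∀ i, MeasurableSet[F] (B i)) {ε : ℝ} (hε : 0 < ε) :
    ∃ k ≠ (0 : Fin n → ℤ), ∀ i,
      (1 / 2) ^ n * μ.real (A i ∩ B i) - ε ≤ μ.real (A i ∩ (k +ᵥ B i)) := by
  obtain ⟨h, E, hseq⟩ := hT.exists_isTowerSeq
  obtain ⟨A₀, hA₀, hne⟩ := hprop
  have hpos : 0 < (relIndepJoining μ hF.le).real (A₀ ×ˢ A₀ᶜ) := by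
    refine lt_of_le_of_ne measureReal_nonneg fun h0 => ?_
    obtain ⟨B, hB, hAB⟩ := exists_ae_eq_of_relIndepJoining_eq_zero μ hF.le hA₀ h0.symm
    exact hne B hB hAB
  obtain ⟨t, ⟨ht0, ht1⟩, htn⟩ : ∃ t ∈ Set.Ioo (0 : ℝ) (1 / 2),
      (1 / 2) ^ n - ε / 2 < (1 / 2 - t) ^ n := by
    have hlim : Tendsto (fun t : ℝ => (1 / 2 - t) ^ n) (𝓝[>] 0) (𝓝 ((1 / 2 - 0) ^ n)) :=
      (Continuous.tendsto (by fun_prop) 0).mono_left nhdsWithin_le_nhds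
    rw [sub_zero] at hlim
    have hIoo : ∀ᶠ t in 𝓝[>] (0 : ℝ), t ∈ Set.Ioo (0 : ℝ) (1 / 2) :=
      Ioo_mem_nhdsGT (by norm_num)
    exact (hIoo.and (hlim.eventually (lt_mem_nhds (by linarith)))).exists
  obtain ⟨k, hk, hle⟩ := hseq.exists_ne_zero_le (pow_pos ht0 n)
    (fun j => exists_centre_rectFinset ht0 ht1 (h j)) (hF.isSelfJoining μ) hA₀ hpos
    (fun i => hF.le _ (hA i)) (fun i => hF.le _ (hB i))
    (fun i => relIndepJoining_prod_compl_eq_zero μ hF.le ((hA i).inter (hB i)) (hB i)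
      Set.inter_subset_right) (half_pos hε)
  refine ⟨k, hk, fun i => ?_⟩
  have h1 := hle i
  have h2 : ((1 / 2) ^ n - ε / 2) * μ.real (A i ∩ B i) ≤ (1 / 2 - t) ^ n * μ.real (A i ∩ B i) :=
    mul_le_mul_of_nonneg_right htn.le measureReal_nonneg
  have h3 : ε / 2 * μ.real (A i ∩ B i) ≤ ε / 2 :=
    mul_le_of_le_one_right (by positivity) measureReal_le_one
  linarith

end

/-! ### The rigidity sequence -/

/-- The sets of a sub-σ-algebra of a countably generated σ-algebra form a separable space for the
distance `μ (A ∆ B)`, as a subspace of `L²`. -/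
lemma exists_dense_seq_measurableSet {X : Type*} {F : MeasurableSpace X} [m : MeasurableSpace X]
    [MeasurableSpace.CountablyGenerated X] (μ : Measure X) [IsProbabilityMeasure μ] (hle : F ≤ m) :
    ∃ D : ℕ → Set X, (∀ l, MeasurableSet[F] (D l)) ∧
      ∀ A, MeasurableSet[F] A → ∀ ε > 0, ∃ l, μ.real (symmDiff A (D l)) < ε := by
  have : Fact ((2 : ℝ≥0∞) ≠ ∞) := ⟨by norm_num⟩
  let f : {A : Set X // MeasurableSet[F] A} → Lp ℝ 2 μ := fun A => ind μ (hle _ A.2)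
  have : Nonempty (Set.range f) := ⟨⟨_, ⟨⟨∅, @MeasurableSet.empty X F⟩, rfl⟩⟩⟩
  obtain ⟨u, hu⟩ := TopologicalSpace.exists_dense_seq (Set.range f)
  choose D hD using fun l => (u l).2
  refine ⟨fun l => (D l).1, fun l => (D l).2, fun A hA ε hε => ?_⟩
  have hr : 0 < ε ^ (1 / 2 : ℝ) := Real.rpow_pos_of_pos hε _
  obtain ⟨l, hl⟩ := hu.exists_dist_lt (⟨f ⟨A, hA⟩, ⟨_, rfl⟩⟩ : Set.range f) hr
  refine ⟨l, ?_⟩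
  rw [Subtype.dist_eq, ← hD l] at hl
  simp only [f, ind] at hl
  rw [dist_indicatorConstLp_eq_norm, norm_indicatorConstLp (by norm_num) (by norm_num)] at hl
  simp only [norm_one, one_mul, ENNReal.toReal_ofNat] at hl
  exact (Real.rpow_lt_rpow_iff measureReal_nonneg hε.le (by norm_num)).1 hl

section

variable {n : ℕ} {X : Type*} {F : MeasurableSpace X} [m : MeasurableSpace X]
  {μ : Measure X} [IsProbabilityMeasure μ]
  [AddAction (Fin n → ℤ) X] [MeasurableConstVAdd (Fin n → ℤ) X]
  [VAddInvariantMeasure (Fin n → ℤ) X μ]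

/-- The sequence `k` tends to infinity, and `liminf μ (A ∩ T_{k j} B) ≥ c μ (A ∩ B)` for all sets
`A`, `B` of `F`. The lower limit is expressed by errors `ε > 0`. -/
def HasRigiditySeq (μ : Measure X) (F : MeasurableSpace X) (c : ℝ) (k : ℕ → Fin n → ℤ) : Prop :=
  Tendsto (fun j => ‖k j‖) atTop atTop ∧ ∀ A B : Set X, MeasurableSet[F] A → MeasurableSet[F] B →
    ∀ ε > 0, ∀ᶠ j in atTop, c * μ.real (A ∩ B) - ε ≤ μ.real (A ∩ (k j +ᵥ B))

omit [MeasurableConstVAdd (Fin n → ℤ) X] in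
/-- If a nonzero `k` fixes every set of `F` up to null sets, its multiples are a rigidity
sequence. -/
lemma hasRigiditySeq_of_periodic {c : ℝ} (hc : c ≤ 1) {k : Fin n → ℤ} (hk : k ≠ 0)
    (hper : ∀ A, MeasurableSet[F] A → μ.real (A \ (k +ᵥ A)) = 0) :
    HasRigiditySeq μ F c fun j : ℕ => j • k := by
  constructor
  · have h1 : ∀ j : ℕ, ‖j • k‖ = j * ‖k‖ := fun j => by
      rw [← natCast_zsmul, norm_smul]; simp
    simp_rw [h1]
    exact tendsto_natCast_atTop_atTop.atTop_mul_const (norm_pos_iff.2 hk)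
  · intro A B hA hB ε hε
    have hz : ∀ j : ℕ, μ.real (B \ ((j • k) +ᵥ B)) = 0 := by
      intro j
      induction j with
      | zero => simp
      | succ j ih =>
        have h1 : B \ (((j + 1) • k) +ᵥ B) ⊆
            (B \ (k +ᵥ B)) ∪ (k +ᵥ (B \ ((j • k) +ᵥ B))) := by
          rintro x ⟨hxB, hx⟩
          by_cases hxk : x ∈ k +ᵥ B
          · right
            rw [Set.vadd_set_sdiff, vadd_vadd, ← succ_nsmul']
            exact ⟨hxk, hx⟩
          · exact Or.inl ⟨hxB, hxk⟩
        refine le_antisymm ((measureReal_mono h1).trans ((measureReal_union_le _ _).trans ?_))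
          measureReal_nonneg
        rw [measureReal_vadd, ih, hper B hB, add_zero]
    refine Eventually.of_forall fun j => ?_
    have h2 : μ.real (A ∩ B) ≤ μ.real (A ∩ ((j • k) +ᵥ B)) + μ.real (B \ ((j • k) +ᵥ B)) := by
      refine (measureReal_mono ?_).trans (measureReal_union_le _ _)
      rintro x ⟨hxA, hxB⟩
      by_cases hx : x ∈ (j • k) +ᵥ B
      · exact Or.inl ⟨hxA, hx⟩
      · exact Or.inr ⟨hxB, hx⟩
    rw [hz, add_zero] at h2
    have h3 : c * μ.real (A ∩ B) ≤ μ.real (A ∩ B) := mul_le_of_le_one_left measureReal_nonneg hc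
    linarith

omit [MeasurableConstVAdd (Fin n → ℤ) X] in
/-- A set of positive measure disjoint from its translate is never partially rigid, so adding such
sets to a finite family excludes any finite set of group elements. -/
lemma exists_seq_of_finite_family {c : ℝ} (hc : 0 < c) [MeasurableSpace.CountablyGenerated X]
    (hF : IsFactor n m F)
    (hfin : ∀ (ι : Type) [Fintype ι] (A B : ι → Set X), (∀ i, MeasurableSet[F] (A i)) →
      (∀ i, MeasurableSet[F] (B i)) → ∀ ε > 0, ∃ k ≠ (0 : Fin n → ℤ), ∀ i,
        c * μ.real (A i ∩ B i) - ε ≤ μ.real (A i ∩ (k +ᵥ B i)))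
    (hnp : ∀ k ≠ (0 : Fin n → ℤ), ∃ A, MeasurableSet[F] A ∧ μ.real (A \ (k +ᵥ A)) ≠ 0) :
    ∃ k : ℕ → Fin n → ℤ, HasRigiditySeq μ F c k := by
  -- for every `k ≠ 0` a set of positive measure that is disjoint from its image under `k`
  have hdisj : ∀ k : Fin n → ℤ, ∃ S, MeasurableSet[F] S ∧
      (k ≠ 0 → 0 < μ.real S ∧ S ∩ (k +ᵥ S) = ∅) := by
    intro k
    by_cases hk : k = 0
    · exact ⟨∅, @MeasurableSet.empty X F, fun h => absurd hk h⟩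
    obtain ⟨A, hA, hne⟩ := hnp k hk
    refine ⟨A \ (k +ᵥ A), hA.diff (hF.invariant k A hA), fun _ =>
      ⟨lt_of_le_of_ne measureReal_nonneg hne.symm, ?_⟩⟩
    ext x
    simp only [Set.vadd_set_sdiff, Set.mem_inter_iff, Set.mem_sdiff, Set.mem_empty_iff_false]
    tauto
  choose S hS hSk using hdisj
  obtain ⟨D, hDF, hD⟩ := exists_dense_seq_measurableSet μ hF.le
  have hstep : ∀ j : ℕ, ∃ k : Fin n → ℤ, (j : ℝ) ≤ ‖k‖ ∧ ∀ l ≤ j, ∀ l' ≤ j,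
      c * μ.real (D l ∩ D l') - 1 / (j + 1) ≤ μ.real (D l ∩ (k +ᵥ D l')) := by
    intro j
    have hball : (Metric.closedBall (0 : Fin n → ℤ) j \ {0}).Finite :=
      (isCompact_closedBall _ _).finite_of_discrete.subset Set.sdiff_subset
    obtain ⟨r, hr, hrS⟩ : ∃ r > 0, ∀ k ∈ hball.toFinset, r < c * μ.real (S k) := by
      have hev : ∀ᶠ r in 𝓝[>] (0 : ℝ), ∀ k ∈ hball.toFinset, r < c * μ.real (S k) := by
        refine (Finset.eventually_all _).2 fun k hk => ?_
        have hk0 : k ≠ 0 := ((Set.Finite.mem_toFinset _).1 hk).2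
        exact nhdsWithin_le_nhds (gt_mem_nhds (mul_pos hc (hSk k hk0).1))
      obtain ⟨r, h1, h2⟩ := (hev.and self_mem_nhdsWithin).exists
      exact ⟨r, h2, h1⟩
    let K := {k : Fin n → ℤ // k ∈ hball.toFinset}
    obtain ⟨k, hk0, hk⟩ := hfin ((Fin (j + 1) × Fin (j + 1)) ⊕ K)
      (Sum.elim (fun p => D p.1) (fun k => S k.1)) (Sum.elim (fun p => D p.2) (fun k => S k.1))
      (by rintro (p | k) <;> simp [hDF, hS]) (by rintro (p | k) <;> simp [hDF, hS])
      (min r (1 / (j + 1))) (lt_min hr (by positivity))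
    refine ⟨k, ?_, fun l hl l' hl' => ?_⟩
    · by_contra! hlt
      have hmem : k ∈ hball.toFinset := by
        rw [Set.Finite.mem_toFinset]
        exact ⟨by simpa using hlt.le, hk0⟩
      have h1 := hk (Sum.inr ⟨k, hmem⟩)
      simp only [Sum.elim_inr, Set.inter_self, (hSk k hk0).2, measureReal_empty] at h1
      have h2 := hrS k hmem
      have h3 := min_le_left r (1 / ((j : ℝ) + 1))
      linarith
    · have h1 := hk (Sum.inl (⟨l, by omega⟩, ⟨l', by omega⟩))
      simp only [Sum.elim_inl] at h1
      have h3 := min_le_right r (1 / ((j : ℝ) + 1))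
      linarith
  choose k hknorm hk using hstep
  refine ⟨k, tendsto_atTop_mono hknorm tendsto_natCast_atTop_atTop, fun A B hA hB ε hε => ?_⟩
  have hε' : 0 < ε / (4 * (c + 1)) := by positivity
  obtain ⟨l, hl⟩ := hD A hA _ hε'
  obtain ⟨l', hl'⟩ := hD B hB _ hε'
  have hlim : ∀ᶠ j : ℕ in atTop, 1 / ((j : ℝ) + 1) < ε / 4 :=
    tendsto_one_div_add_atTop_nhds_zero_nat.eventually (gt_mem_nhds (by positivity))
  filter_upwards [hlim, eventually_ge_atTop l, eventually_ge_atTop l'] with j h1 h2 h3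
  have h4 := hk j l h2 l' h3
  -- both sides of the inequality change little when `D l`, `D l'` are replaced by `A`, `B`
  have h5 : μ.real (A ∩ B) ≤ μ.real (D l ∩ D l') + μ.real (symmDiff A (D l)) +
      μ.real (symmDiff B (D l')) := by
    refine (measureReal_mono (s₂ := (D l ∩ D l' ∪ symmDiff A (D l)) ∪ symmDiff B (D l')) ?_).trans
      ((measureReal_union_le _ _).trans (add_le_add_left (measureReal_union_le _ _) _))
    intro x hx
    simp only [Set.mem_inter_iff, Set.mem_union, Set.mem_symmDiff] at *
    tauto
  have h6 : μ.real (D l ∩ (k j +ᵥ D l')) ≤ μ.real (A ∩ (k j +ᵥ B)) + μ.real (symmDiff A (D l)) +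
      μ.real (symmDiff B (D l')) := by
    rw [← measureReal_vadd μ (k j) (symmDiff B (D l'))]
    refine (measureReal_mono (s₂ := (A ∩ (k j +ᵥ B) ∪ symmDiff A (D l)) ∪
      (k j +ᵥ symmDiff B (D l'))) ?_).trans
      ((measureReal_union_le _ _).trans (add_le_add_left (measureReal_union_le _ _) _))
    rw [Set.vadd_set_symmDiff]
    intro x hx
    simp only [Set.mem_inter_iff, Set.mem_union, Set.mem_symmDiff] at *
    tauto
  have h7 : c * μ.real (A ∩ B) ≤ c * (μ.real (D l ∩ D l') + 2 * (ε / (4 * (c + 1)))) :=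
    mul_le_mul_of_nonneg_left (by linarith) hc.le
  have h8 : (c + 1) * (ε / (4 * (c + 1))) = ε / 4 := by field_simp
  nlinarith

omit [MeasurableConstVAdd (Fin n → ℤ) X] [VAddInvariantMeasure (Fin n → ℤ) X μ] in
/-- Passage from real-valued measures with errors to the lower limit of `ℝ≥0∞`-valued measures. -/
lemma HasRigiditySeq.le_liminf {k : ℕ → Fin n → ℤ} (h : HasRigiditySeq μ F ((1 / 2) ^ n) k)
    {A B : Set X} (hA : MeasurableSet[F] A) (hB : MeasurableSet[F] B) :
    (1 / 2 ^ n : ℝ≥0∞) * μ (A ∩ B) ≤ liminf (fun j => μ (A ∩ (k j +ᵥ B))) atTop := by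
  have heq : (1 / 2 ^ n : ℝ≥0∞) * μ (A ∩ B) = ENNReal.ofReal ((1 / 2) ^ n * μ.real (A ∩ B)) := by
    rw [ENNReal.ofReal_mul (by positivity), ofReal_measureReal, ENNReal.ofReal_pow (by norm_num),
      ENNReal.ofReal_div_of_pos (by norm_num), one_div, ENNReal.inv_pow]
    simp
  rw [heq]
  refine ENNReal.le_of_forall_pos_le_add fun ε hε _ => ?_
  have h1 : ENNReal.ofReal ((1 / 2) ^ n * μ.real (A ∩ B) - ε) ≤
      liminf (fun j => μ (A ∩ (k j +ᵥ B))) atTop := by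
    refine le_liminf_of_le (by isBoundedDefault) ?_
    filter_upwards [h.2 A B hA hB ε hε] with j hj
    rw [← ofReal_measureReal]
    exact ENNReal.ofReal_le_ofReal hj
  calc ENNReal.ofReal ((1 / 2) ^ n * μ.real (A ∩ B))
      = ENNReal.ofReal (((1 / 2) ^ n * μ.real (A ∩ B) - ε) + ε) := by rw [sub_add_cancel]
    _ ≤ ENNReal.ofReal ((1 / 2) ^ n * μ.real (A ∩ B) - ε) + ENNReal.ofReal ε :=
        ENNReal.ofReal_add_le
    _ ≤ _ := by
        rw [ENNReal.ofReal_coe_nnreal]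
        exact add_le_add_left h1 _

lemma IsRankOne.exists_hasRigiditySeq [StandardBorelSpace X] [NullSingletonClass μ]
    (hT : IsRankOne n μ) (hF : IsFactor n m F) (hprop : IsProper μ F) :
    ∃ k : ℕ → Fin n → ℤ, HasRigiditySeq μ F ((1 / 2) ^ n) k := by
  by_cases hper : ∃ k ≠ (0 : Fin n → ℤ), ∀ A, MeasurableSet[F] A → μ.real (A \ (k +ᵥ A)) = 0
  · obtain ⟨k, hk, hper⟩ := hper
    exact ⟨_, hasRigiditySeq_of_periodic (pow_le_one₀ (by norm_num) (by norm_num)) hk hper⟩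
  · push Not at hper
    exact exists_seq_of_finite_family (by positivity) hF
      (fun ι _ A B hA hB ε hε => hT.exists_ne_zero_le hF hprop hA hB hε) hper

end

end RankOneZn

theorem mainTheorem8 (n : ℕ) (hn : 1 ≤ n) {X : Type*} [m : MeasurableSpace X]
    [StandardBorelSpace X] (μ : Measure X) [IsProbabilityMeasure μ] [NullSingletonClass μ]
    [AddAction (Fin n → ℤ) X] [MeasurableConstVAdd (Fin n → ℤ) X]
    [VAddInvariantMeasure (Fin n → ℤ) X μ]
    (hT : RankOneZn.IsRankOne n μ)
    (F : MeasurableSpace X) (hF : RankOneZn.IsFactor n m F) (hFproper : RankOneZn.IsProper μ F) :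
    ∃ k : ℕ → Fin n → ℤ, Tendsto (fun j => ‖k j‖) atTop atTop ∧
      ∀ A B : Set X, MeasurableSet[F] A → MeasurableSet[F] B →
        (1 / 2 ^ n : ℝ≥0∞) * μ (A ∩ B) ≤ liminf (fun j => μ (A ∩ (k j +ᵥ B))) atTop := by
  obtain ⟨k, hk⟩ := @RankOneZn.IsRankOne.exists_hasRigiditySeq n X F m μ _ _ _ _ _ _ hT hF hFproper
  exact ⟨k, hk.1, fun A B hA hB => @RankOneZn.HasRigiditySeq.le_liminf n X F m μ _ _ k hk A B hA hB⟩
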